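/- In an edge-colored graph (the coloring need not be proper), call a subgraph rainbow if all its edges have distinct colors; for a real $\Delta$, call an edge-coloring of a graph $G$ globally $\Delta$-bounded if each color appears on at most $\Delta$ edges of $G$. Let $G(n,p)$ denote the binomial random graph on $n$ vertices, in which each pair of vertices forms an edge independently with probability $p$. **Theorem.** There exists a constant $\mu>0$ such that for every sequence $p=p(n)\in[0,1]$ with $p \gg \frac{\log n}{n}$ (that is, $\frac{\log n}{n}=o(p(n))$ as $n\to\infty$), the random graph $G=G(n,p)$ has the following property with probability tending to $1$ as $n\to\infty$: every globally $\mu np$-bounded edge-coloring of $G$ contains a rainbow Hamilton cycle. -/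

import Mathlib

namespace RainbowHamilton

/-- An edge-coloring `c` of `G` (an arbitrary assignment of colors to the edges of `G`) is globally
`Δ`-bounded if every color appears on at most `Δ` edges of `G`. -/
def IsGloballyBounded {V K : Type*} {G : SimpleGraph V} (c : G.EdgeLabeling K) (Δ : ℝ) : Prop :=
  ∀ k : K, {e : G.edgeSet | c e = k}.Finite ∧ ({e : G.edgeSet | c e = k}.ncard : ℝ) ≤ Δ

/-- A subgraph `H` of an edge-colored graph `G` is rainbow if all its edges have distinct
colors. -/
def IsRainbow {V K : Type*} {G : SimpleGraph V} (c : G.EdgeLabeling K) (H : G.Subgraph) : Prop :=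
  ∀ e f : G.edgeSet, (e : Sym2 V) ∈ H.edgeSet → (f : Sym2 V) ∈ H.edgeSet → e ≠ f → c e ≠ c f

/-- The edge-colored graph `G` contains a rainbow Hamilton cycle. -/
def HasRainbowHamiltonCycle {V K : Type*} [DecidableEq V] {G : SimpleGraph V}
    (c : G.EdgeLabeling K) : Prop :=
  ∃ (v : V) (w : G.Walk v v), w.IsHamiltonianCycle ∧ IsRainbow c w.toSubgraph

end RainbowHamilton

/-! Put `np = w²`, so that `w → ∞`. The cycle is built by Pósa's rotation-extension method, using
edges of distinct colours only. If every nonempty set of at most `s` vertices expands fourfold,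
rotating a longest path with one end fixed yields more than `s` other ends
(`IsExpander.lt_card_rotEnds`). Doing this from both sides gives at least `s²/2` boosters, pairs
whose addition creates a Hamilton cycle or raises `progress` (`IsExpander.sq_le_card_boosters`).
Since `progress` never exceeds `2n`, only linearly many additions are needed.

The rainbow starting graph comes from letting each vertex choose 16 incident edges at random,
conditioned on all chosen colours being different. By a counting argument in the spirit of the local
lemma, each further coordinate required to be rainbow costs a factor of at most 2
(`card_rainbowChoices_le_two_mul`). Hence conditioning inflates the probability of an event on `k`
coordinates by at most `2^k` (`exists_rainbow_choice`), and a union bound leaves an expander with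
`s` linear in `n` (`exists_rainbow_expander`).

A rainbow graph with at most `18n` edges blocks at most `18n · μnp` edges through its colours. If
order `n²p` of its boosters lie in `G`, then for small `μ` one of them has a new colour
(`exists_rainbow_isHamiltonian`).

Randomness supplies only colour-free properties, so all colourings are handled at once: large
degrees, no dense sets of small or medium size, and many boosters in `G` for each `F ⊆ G` with at
most `18n` edges. The last is a union bound over `F`: the weights `p^|F|` sum to `e^{O(nw)}`,
against a Chernoff factor `e^{-Ω(nw²)}`. -/

namespace RainbowHamilton

open Finset

/-! ### Pósa rotations of paths. -/

/-- The list `l` traverses a path of `H`. -/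
def IsPathList {V : Type*} (H : SimpleGraph V) (l : List V) : Prop :=
  l.IsChain H.Adj ∧ l.Nodup

/-- The lists obtained from `l` by repeated Pósa rotations that keep the last vertex fixed. -/
inductive RotReach {V : Type*} (H : SimpleGraph V) (l : List V) : List V → Prop
  | refl : RotReach H l l
  | rot (e x : V) (B A : List V) : RotReach H l (e :: B ++ x :: A) → H.Adj e x →
      RotReach H l ((e :: B).reverse ++ x :: A)

section Posa

variable {V : Type*} {H : SimpleGraph V} {l : List V}

/-- The relation is an arbitrary symmetric one because it is used twice: for adjacency, and for the
invariant in `RotReach.exists_listNbr`. -/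
lemma isChain_rotate {R : V → V → Prop} (hR : ∀ a b, R a b → R b a) {e x : V} {B A : List V}
    (h : (e :: B ++ x :: A).IsChain R) (hex : R e x) :
    ((e :: B).reverse ++ x :: A).IsChain R := by
  rw [List.isChain_append] at h ⊢
  refine ⟨?_, h.2.1, ?_⟩
  · rw [List.isChain_reverse]
    exact h.1.imp (fun a b hab => hR _ _ hab)
  · intro a ha b hb
    simp only [List.getLast?_reverse, List.head?_cons, Option.mem_def, Option.some.injEq] at ha hb
    subst ha; subst hb; exact hex

lemma RotReach.perm {l' : List V} (h : RotReach H l l') : l'.Perm l := by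
  induction h with
  | refl => rfl
  | rot e x B A _ _ ih => exact ((List.reverse_perm _).append_right _).trans ih

lemma RotReach.isPathList {l' : List V} (h : RotReach H l l') (hl : IsPathList H l) :
    IsPathList H l' := by
  induction h with
  | refl => exact hl
  | rot e x B A h hex ih =>
    exact ⟨isChain_rotate (fun a b hab => hab.symm) ih.1 hex,
      (((List.reverse_perm (e :: B)).append_right (x :: A)).nodup_iff).2 ih.2⟩

lemma RotReach.getLast? {l' : List V} (h : RotReach H l l') : l'.getLast? = l.getLast? := by
  induction h with
  | refl => rfl
  | rot e x B A _ _ ih =>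
    rw [← ih, List.getLast?_append, List.getLast?_append, List.getLast?_eq_some_getLast (by simp)]
    rfl

/-- `b` is next to `w` in the list `l`. -/
def ListNbr (l : List V) (w b : V) : Prop :=
  ∃ i, (l[i]? = some w ∧ l[i + 1]? = some b) ∨ (l[i]? = some b ∧ l[i + 1]? = some w)

/-- If no `l`-neighbour of `w` ever became a first vertex, the list-neighbours of `w` would always
be among the original ones. A rotation creates only the adjacency `e x`: here `e = w` is excluded
since `w` is never first, and `x = w` would bring the predecessor of `w` to the front. Rotating `l₁`
along `u w` then gives the contradiction. -/
lemma RotReach.exists_listNbr (hmax : ∀ l' u w, RotReach H l l' → l'.head? = some u →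
      H.Adj u w → w ∈ l')
    {l₁ : List V} {u w : V} (h₁ : RotReach H l l₁) (hu : l₁.head? = some u) (huw : H.Adj u w)
    (hw : ∀ l', RotReach H l l' → l'.head? ≠ some w) :
    ∃ l' b, RotReach H l l' ∧ l'.head? = some b ∧ ListNbr l w b := by
  by_contra! hcon
  have key : ∀ l', RotReach H l l' →
      l'.IsChain (fun a b => (a = w → ListNbr l w b) ∧ (b = w → ListNbr l w a)) := by
    intro l' h
    induction h with
    | refl =>
      rw [List.isChain_iff_getElem]
      intro i hi
      refine ⟨fun h => ⟨i, Or.inl ⟨?_, ?_⟩⟩, fun h => ⟨i, Or.inr ⟨?_, ?_⟩⟩⟩ <;>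
        simp_all [Nat.lt_of_succ_lt]
    | rot e x B A h hex ih =>
      refine isChain_rotate (fun a b hab => ⟨hab.2, hab.1⟩) ih ⟨fun he => ?_, fun hx => ?_⟩
      · exact absurd (by simp [he]) (hw _ h)
      · have h2 := RotReach.rot e x B A h hex
        rw [List.isChain_append] at ih
        have h3 := ih.2.2 ((e :: B).getLast (by simp)) (by simp [List.getLast?_eq_some_getLast])
          x (by simp)
        exact absurd (h3.2 hx) (hcon _ _ h2 (by
          rw [List.head?_append, List.head?_reverse, List.getLast?_eq_some_getLast (by simp)]; rfl))
  obtain ⟨B', hB'⟩ : ∃ B', l₁ = u :: B' := by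
    cases l₁ with
    | nil => simp at hu
    | cons a t => simp at hu; exact ⟨t, by rw [hu]⟩
  have hwl := hmax _ _ _ h₁ hu huw
  rw [hB', List.mem_cons] at hwl
  rcases hwl with rfl | hwl
  · exact huw.ne rfl
  obtain ⟨B, A, rfl⟩ := List.append_of_mem hwl
  rw [hB'] at h₁
  have h2 := RotReach.rot u w B A h₁ huw
  have ih := key _ h₁
  rw [← List.cons_append, List.isChain_append] at ih
  have h3 := ih.2.2 ((u :: B).getLast (by simp)) (by simp [List.getLast?_eq_some_getLast])
    w (by simp)
  exact absurd (h3.2 rfl) (hcon _ _ h2 (by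
    rw [List.head?_append, List.head?_reverse, List.getLast?_eq_some_getLast (by simp)]; rfl))

end Posa

/-! ### Expansion forces many rotation endpoints. -/

section Expander

variable {V : Type*} [Fintype V] {H : SimpleGraph V}

open Classical in
/-- The vertices that have a neighbour in `X`. -/
noncomputable def nbhd (H : SimpleGraph V) (X : Finset V) : Finset V :=
  univ.filter fun w => ∃ x ∈ X, H.Adj x w

lemma mem_nbhd {X : Finset V} {w : V} : w ∈ nbhd H X ↔ ∃ x ∈ X, H.Adj x w := by
  simp [nbhd]

open Classical in
/-- The first vertices of the lists reachable from `l` by rotations. -/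
noncomputable def rotEnds (H : SimpleGraph V) (l : List V) : Finset V :=
  univ.filter fun b => ∃ l', RotReach H l l' ∧ l'.head? = some b

lemma mem_rotEnds {l : List V} {b : V} :
    b ∈ rotEnds H l ↔ ∃ l', RotReach H l l' ∧ l'.head? = some b := by
  simp [rotEnds]

variable [DecidableEq V]

/-- Every nonempty set of at most `s` vertices has a fourfold expansion. -/
def IsExpander (H : SimpleGraph V) (s : ℕ) : Prop :=
  ∀ X : Finset V, X.Nonempty → X.card ≤ s → 4 * X.card ≤ (X ∪ nbhd H X).card

lemma IsExpander.mono {H' : SimpleGraph V} {s : ℕ} (h : IsExpander H s) (hH : H ≤ H') :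
    IsExpander H' s := by
  intro X hX hs
  refine (h X hX hs).trans (card_le_card (union_subset_union_right ?_))
  intro w hw
  rw [mem_nbhd] at hw ⊢
  obtain ⟨x, hx, hxw⟩ := hw
  exact ⟨x, hx, hH hxw⟩

/-- A neighbour of an endpoint is an endpoint itself or the successor or predecessor in `l` of one.
Past the end of `l` the default value `b` is harmless, as is the truncated subtraction at index 0.
-/
lemma nbhd_rotEnds_subset {l : List V} (hl : l.Nodup)
    (hmax : ∀ l' u w, RotReach H l l' → l'.head? = some u → H.Adj u w → w ∈ l') :
    nbhd H (rotEnds H l) ⊆ rotEnds H l ∪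
      ((rotEnds H l).image (fun b => l.getD (l.idxOf b + 1) b) ∪
        (rotEnds H l).image (fun b => l.getD (l.idxOf b - 1) b)) := by
  intro w hw
  rw [mem_nbhd] at hw
  obtain ⟨u, hu, huw⟩ := hw
  by_cases hwR : w ∈ rotEnds H l
  · exact mem_union_left _ hwR
  refine mem_union_right _ ?_
  obtain ⟨l₁, h₁, hu⟩ := mem_rotEnds.1 hu
  obtain ⟨l', b, hl', hb, i, hi⟩ := RotReach.exists_listNbr hmax h₁ hu huw
    (fun l' hl' hh => hwR (mem_rotEnds.2 ⟨l', hl', hh⟩))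
  have hbR : b ∈ rotEnds H l := mem_rotEnds.2 ⟨l', hl', hb⟩
  have hidx : ∀ j, l[j]? = some b → l.idxOf b = j := by
    intro j hj
    obtain ⟨hj', rfl⟩ := List.getElem?_eq_some_iff.1 hj
    exact hl.idxOf_getElem j hj'
  rcases hi with ⟨h1, h2⟩ | ⟨h1, h2⟩
  · refine mem_union_right _ (mem_image.2 ⟨b, hbR, ?_⟩)
    rw [hidx _ h2, Nat.add_sub_cancel, List.getD_eq_getElem?_getD, h1]; rfl
  · refine mem_union_left _ (mem_image.2 ⟨b, hbR, ?_⟩)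
    rw [hidx _ h1, List.getD_eq_getElem?_getD, h2]; rfl

/-- **Pósa's lemma**: in an expander, a path that cannot be extended has many endpoints under
rotation. -/
lemma IsExpander.lt_card_rotEnds {s : ℕ} (hH : IsExpander H s) {l : List V} (hl : IsPathList H l)
    (hne : l ≠ []) (hmax : ∀ l', IsPathList H l' → l'.length ≤ l.length) :
    s < (rotEnds H l).card := by
  by_contra! hcard
  obtain ⟨a, t, rfl⟩ := List.exists_cons_of_ne_nil hne
  have hR : (rotEnds H (a :: t)).Nonempty := ⟨a, mem_rotEnds.2 ⟨_, .refl, rfl⟩⟩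
  have h4 := hH _ hR hcard
  have hsub := nbhd_rotEnds_subset (H := H) hl.2 (fun l' u w hl' hu huw => by
    by_contra hw
    have hp := hl'.isPathList hl
    have := hmax (w :: l') ⟨?_, List.nodup_cons.2 ⟨hw, hp.2⟩⟩
    · rw [List.length_cons, hl'.perm.length_eq] at this; omega
    · rw [List.isChain_cons]
      refine ⟨fun y hy => ?_, hp.1⟩
      rw [hu, Option.mem_def, Option.some.injEq] at hy
      subst hy; exact huw.symm)
  -- Endpoints, their successors and their predecessors number at most three times the endpoints,
  -- which contradicts fourfold expansion.
  have h5 := card_le_card (union_subset (subset_union_left) hsub)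
  have h6 := card_union_le (rotEnds H (a :: t))
    ((rotEnds H (a :: t)).image (fun b => (a :: t).getD ((a :: t).idxOf b + 1) b) ∪
        (rotEnds H (a :: t)).image (fun b => (a :: t).getD ((a :: t).idxOf b - 1) b))
  have h7 := card_union_le ((rotEnds H (a :: t)).image
      (fun b => (a :: t).getD ((a :: t).idxOf b + 1) b))
        ((rotEnds H (a :: t)).image (fun b => (a :: t).getD ((a :: t).idxOf b - 1) b))
  have h8 := card_image_le (s := rotEnds H (a :: t))
    (f := fun b => (a :: t).getD ((a :: t).idxOf b + 1) b)
  have h9 := card_image_le (s := rotEnds H (a :: t))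
    (f := fun b => (a :: t).getD ((a :: t).idxOf b - 1) b)
  have := hR.card_pos
  omega

end Expander

end RainbowHamilton

namespace RainbowHamilton

open Finset

/-! ### Longest paths and components as a measure of progress. -/

section Progress

variable {V : Type*} {H H' : SimpleGraph V}

lemma IsPathList.mono {l : List V} (hl : IsPathList H l) (h : H ≤ H') : IsPathList H' l :=
  ⟨hl.1.imp fun _ _ hab => h hab, hl.2⟩

lemma surjective_componentMap (h : H ≤ H') :
    Function.Surjective (SimpleGraph.ConnectedComponent.map (SimpleGraph.Hom.ofLE h)) := by
  intro c
  induction c using SimpleGraph.ConnectedComponent.ind with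
  | h v => exact ⟨H.connectedComponentMk v, rfl⟩

variable [Fintype V]

lemma IsPathList.length_le {l : List V} (hl : IsPathList H l) : l.length ≤ Fintype.card V :=
  hl.2.length_le_card

/-- The largest number of vertices on a path of `H`. -/
noncomputable def longest (H : SimpleGraph V) : ℕ := sSup {k | ∃ l, IsPathList H l ∧ l.length = k}

lemma bddAbove_lengths (H : SimpleGraph V) : BddAbove {k | ∃ l, IsPathList H l ∧ l.length = k} :=
  ⟨Fintype.card V, by rintro k ⟨l, hl, rfl⟩; exact hl.length_le⟩

lemma IsPathList.length_le_longest {l : List V} (hl : IsPathList H l) : l.length ≤ longest H :=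
  le_csSup (bddAbove_lengths H) ⟨l, hl, rfl⟩

lemma exists_isPathList_length_eq (H : SimpleGraph V) :
    ∃ l, IsPathList H l ∧ l.length = longest H :=
  Nat.sSup_mem (s := {k | ∃ l, IsPathList H l ∧ l.length = k})
    ⟨0, [], ⟨List.IsChain.nil, List.nodup_nil⟩, rfl⟩ (bddAbove_lengths H)

lemma longest_le_card (H : SimpleGraph V) : longest H ≤ Fintype.card V := by
  obtain ⟨l, hl, h⟩ := exists_isPathList_length_eq H
  exact h ▸ hl.length_le

lemma longest_mono (h : H ≤ H') : longest H ≤ longest H' := by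
  obtain ⟨l, hl, hk⟩ := exists_isPathList_length_eq H
  exact hk ▸ (hl.mono h).length_le_longest

lemma card_component_mono (h : H ≤ H') :
    Nat.card H'.ConnectedComponent ≤ Nat.card H.ConnectedComponent :=
  Nat.card_le_card_of_surjective _ (surjective_componentMap h)

lemma card_component_le (H : SimpleGraph V) : Nat.card H.ConnectedComponent ≤ Fintype.card V := by
  rw [← Nat.card_eq_fintype_card]
  exact Nat.card_le_card_of_surjective _ (Quot.mk_surjective)

lemma card_component_lt (h : H ≤ H') {u v : V} (huv : ¬ H.Reachable u v) (hadj : H'.Adj u v) :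
    Nat.card H'.ConnectedComponent < Nat.card H.ConnectedComponent := by
  classical
  have := Fintype.ofFinite H.ConnectedComponent
  have := Fintype.ofFinite H'.ConnectedComponent
  rw [Nat.card_eq_fintype_card, Nat.card_eq_fintype_card]
  refine Fintype.card_lt_of_surjective_not_injective _ (surjective_componentMap h) fun hinj => ?_
  refine huv (SimpleGraph.ConnectedComponent.exact (hinj ?_))
  exact SimpleGraph.ConnectedComponent.sound hadj.reachable

/-- A measure of how close `H` is to being Hamiltonian. -/
noncomputable def progress (H : SimpleGraph V) : ℕ :=
  longest H + (Fintype.card V - Nat.card H.ConnectedComponent)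

lemma progress_le (H : SimpleGraph V) : progress H ≤ 2 * Fintype.card V := by
  have := longest_le_card H
  unfold progress
  omega

lemma progress_lt_of_longest (h : H ≤ H') (hl : longest H < longest H') :
    progress H < progress H' := by
  have := card_component_mono h
  unfold progress
  omega

lemma progress_lt_of_not_reachable (h : H ≤ H') {u v : V} (huv : ¬ H.Reachable u v)
    (hadj : H'.Adj u v) : progress H < progress H' := by
  have h1 := card_component_lt h huv hadj
  have h2 := card_component_le H
  have h3 := longest_mono h
  unfold progress
  omega

variable [DecidableEq V]

lemma isHamiltonian_of_list {a b : V} {l : List V} (hl : IsPathList H l)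
    (ha : l.head? = some a) (hb : l.getLast? = some b) (hab : H.Adj b a)
    (hlen : l.length = Fintype.card V) (h3 : 3 ≤ l.length) : H.IsHamiltonian := by
  intro _
  have hne : l ≠ [] := by rintro rfl; simp at ha
  obtain ⟨w, hw⟩ : ∃ w : H.Walk a b, w.support = l := by
    have h1 : l.head hne = a := by rw [List.head?_eq_some_head hne] at ha; simpa using ha
    have h2 : l.getLast hne = b := by
      rw [List.getLast?_eq_some_getLast hne] at hb; simpa using hb
    subst h1; subst h2
    exact ⟨_, SimpleGraph.Walk.support_ofSupport hne hl.1⟩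
  have hp : w.IsPath := SimpleGraph.Walk.IsPath.mk' (hw ▸ hl.2)
  have hwl : w.length + 1 = l.length := by rw [← hw, SimpleGraph.Walk.length_support]
  refine ⟨b, SimpleGraph.Walk.cons hab w, ?_⟩
  rw [SimpleGraph.Walk.isHamiltonianCycle_iff_isCycle_and_length_eq]
  refine ⟨(SimpleGraph.Walk.cons_isCycle_iff _ _).2 ⟨hp, fun he => ?_⟩, ?_⟩
  · have := hp.length_eq_one_of_mem_edges (u := a) (v := b) (by rwa [Sym2.eq_swap])
    omega
  · rw [SimpleGraph.Walk.length_cons, hwl, hlen]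

/-- Closing up a longest path of a connected graph creates a Hamilton cycle or a longer path. -/
lemma isHamiltonian_or_longest_lt (h : H ≤ H') (hconn : H.Preconnected) {a b : V} {l : List V}
    (hl : IsPathList H l) (hlen : l.length = longest H)
    (ha : l.head? = some a) (hb : l.getLast? = some b) (hab : H'.Adj b a)
    (h3 : 3 ≤ Fintype.card V) : H'.IsHamiltonian ∨ longest H < longest H' := by
  by_cases hall : ∀ v, v ∈ l
  · left
    have hc : l.length = Fintype.card V := by
      refine le_antisymm hl.length_le ?_
      rw [← List.toFinset_card_of_nodup hl.2]
      exact card_le_card fun v _ => by simpa using hall v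
    exact isHamiltonian_of_list (hl.mono h) ha hb hab hc (by omega)
  · right
    push Not at hall
    obtain ⟨v, hv⟩ := hall
    have ham : a ∈ l := List.mem_of_head? ha
    obtain ⟨w⟩ := hconn a v
    obtain ⟨d, hd, hd1, hd2⟩ := w.exists_boundary_dart {x | x ∈ l} ham hv
    simp only [Set.mem_ofPred_eq] at hd1 hd2
    obtain ⟨B, A, hBA⟩ := List.append_of_mem hd1
    -- The path closed by `b a` is a cycle; opening it just before `d.fst` and prepending the
    -- outside vertex `d.snd` gives a longer path.
    have hp : IsPathList H' (d.snd :: (d.fst :: A ++ B)) := by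
      have hl' := hl.mono h
      refine ⟨?_, ?_⟩
      · rw [List.isChain_cons]
        refine ⟨fun y hy => ?_, ?_⟩
        · simp only [List.cons_append, List.head?_cons, Option.mem_def, Option.some.injEq] at hy
          subst hy
          exact h d.adj.symm
        · have hc := hl'.1
          rw [hBA, List.isChain_append] at hc
          rw [List.isChain_append]
          refine ⟨hc.2.1, hc.1, fun y hy z hz => ?_⟩
          rw [hBA, List.head?_append] at ha
          rw [hBA, List.getLast?_append] at hb
          rw [Option.mem_def] at hy hz
          rw [hz] at ha
          rw [hy] at hb
          simp only [Option.some_or, Option.some.injEq] at ha hb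
          subst ha; subst hb; exact hab
      · have hperm : (d.fst :: A ++ B).Perm l := by
          rw [hBA]; exact List.perm_append_comm
        rw [List.nodup_cons, hperm.mem_iff, hperm.nodup_iff]
        exact ⟨hd2, hl.2⟩
    have := hp.length_le_longest
    rw [← hlen, hBA]
    simp only [List.length_cons, List.length_append] at this ⊢
    omega

end Progress

/-! ### Counting boosters of an expander. -/

section Boosters

variable {V : Type*} [Fintype V] [DecidableEq V]

open Classical in
/-- The pairs whose addition to `H` makes it Hamiltonian or increases `progress`. -/
noncomputable def boosters (H : SimpleGraph V) : Finset (Sym2 V) :=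
  univ.filter fun e => ¬ e.IsDiag ∧ ((H ⊔ SimpleGraph.fromEdgeSet {e}).IsHamiltonian ∨
    progress H < progress (H ⊔ SimpleGraph.fromEdgeSet {e}))

lemma mem_boosters {H : SimpleGraph V} {e : Sym2 V} : e ∈ boosters H ↔
    ¬ e.IsDiag ∧ ((H ⊔ SimpleGraph.fromEdgeSet {e}).IsHamiltonian ∨
    progress H < progress (H ⊔ SimpleGraph.fromEdgeSet {e})) := by
  simp [boosters]

lemma card_le_two_mul_card_image_mk {V : Type*} [DecidableEq V] (P : Finset (V × V)) :
    P.card ≤ 2 * (P.image fun q => s(q.1, q.2)).card := by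
  refine card_le_mul_card_image P 2 fun e _ => ?_
  induction e with | h a b
  refine (card_le_card (t := {(a, b), (b, a)}) fun q hq => ?_).trans card_le_two
  simp only [mem_filter, Sym2.eq_iff] at hq
  simp only [mem_insert, mem_singleton, Prod.ext_iff]
  exact hq.2

/-- A component contains its own neighbourhood, so it cannot expand and must be too large for the
expansion hypothesis. -/
lemma IsExpander.lt_card_component {H : SimpleGraph V} {s : ℕ} (hH : IsExpander H s) (u : V)
    [DecidablePred fun v => H.Reachable u v] : s < (univ.filter fun v => H.Reachable u v).card := by
  by_contra! hs
  have hne : (univ.filter fun v => H.Reachable u v).Nonempty := ⟨u, by simp⟩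
  have h4 := hH _ hne hs
  have : nbhd H (univ.filter fun v => H.Reachable u v) ⊆ univ.filter fun v => H.Reachable u v := by
    intro w hw
    obtain ⟨x, hx, hxw⟩ := mem_nbhd.1 hw
    simp only [mem_filter, mem_univ, true_and] at hx ⊢
    exact hx.trans hxw.reachable
  rw [union_eq_left.2 this] at h4
  have := hne.card_pos
  omega

/-- A non-Hamiltonian expander has quadratically many boosters. -/
theorem IsExpander.sq_le_card_boosters {H : SimpleGraph V} {s : ℕ} (hH : IsExpander H s)
    (hs : 1 ≤ s) (h3 : 3 ≤ Fintype.card V) : s ^ 2 ≤ 2 * (boosters H).card := by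
  classical
  suffices ∃ P : Finset (V × V), s ^ 2 ≤ P.card ∧ ∀ q ∈ P, s(q.1, q.2) ∈ boosters H by
    obtain ⟨P, hP, hPB⟩ := this
    have h1 := card_le_two_mul_card_image_mk P
    have h2 : (P.image fun q => s(q.1, q.2)).card ≤ (boosters H).card :=
      card_le_card (image_subset_iff.2 hPB)
    omega
  by_cases hconn : H.Preconnected
  · obtain ⟨l, hl, hlen⟩ := exists_isPathList_length_eq H
    have hmax : ∀ l', IsPathList H l' → l'.length ≤ longest H := fun l' h => h.length_le_longest
    have hV : Nonempty V := Fintype.card_pos_iff.1 (by omega)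
    have hne : ∀ l' : List V, l'.length = longest H → l' ≠ [] := by
      rintro _ h0 rfl
      have := hmax [hV.some] ⟨List.isChain_singleton _, List.nodup_singleton _⟩
      simp at this h0
      omega
    -- Reversal turns each endpoint `a` into a fixed last vertex, so a second round of rotations
    -- produces the partners of `a`.
    have hex : ∀ a ∈ rotEnds H l, ∃ l₁, IsPathList H l₁ ∧ l₁.length = longest H ∧
        l₁.getLast? = some a := by
      intro a ha
      obtain ⟨l', hl', hla⟩ := mem_rotEnds.1 ha
      have hp := hl'.isPathList hl
      refine ⟨l'.reverse, ⟨?_, List.nodup_reverse.2 hp.2⟩, ?_, ?_⟩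
      · rw [List.isChain_reverse]
        exact hp.1.imp fun _ _ h => h.symm
      · rw [List.length_reverse, hl'.perm.length_eq, hlen]
      · rw [List.getLast?_reverse, hla]
    choose! L hL1 hL2 hL3 using hex
    have hend : ∀ l', IsPathList H l' → l'.length = longest H → s < (rotEnds H l').card :=
      fun l' h1 h2 => hH.lt_card_rotEnds h1 (hne _ h2) (fun l'' h => h2 ▸ hmax l'' h)
    refine ⟨(rotEnds H l).biUnion fun a => (rotEnds H (L a)).image fun b => (a, b), ?_, ?_⟩
    · rw [card_biUnion]
      · calc s ^ 2 = s * s := sq s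
          _ ≤ (rotEnds H l).card * s := Nat.mul_le_mul_right _ (hend l hl hlen).le
          _ = ∑ a ∈ rotEnds H l, s := by rw [sum_const, smul_eq_mul]
          _ ≤ _ := by
            refine sum_le_sum fun a ha => ?_
            rw [card_image_of_injective _ (fun b b' h => (Prod.ext_iff.1 h).2)]
            exact (hend _ (hL1 a ha) (hL2 a ha)).le
      · intro a _ b _ hab
        rw [Function.onFun, disjoint_left]
        intro q hq hq'
        obtain ⟨x, _, rfl⟩ := mem_image.1 hq
        obtain ⟨y, _, hy⟩ := mem_image.1 hq'
        exact hab (Prod.ext_iff.1 hy).1.symm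
    · intro q hq
      obtain ⟨a, ha, hq⟩ := mem_biUnion.1 hq
      obtain ⟨b, hb, rfl⟩ := mem_image.1 hq
      obtain ⟨l', hl', hlb⟩ := mem_rotEnds.1 hb
      have hlen2 : 2 ≤ longest H := by
        obtain ⟨x, hx, y, hy, hxy⟩ := one_lt_card.1 (hs.trans_lt (hend l hl hlen))
        have hx' := hl'.perm.length_eq
        by_contra! hlt
        have : l.length ≤ 1 := by omega
        obtain ⟨lx, hlx, hx⟩ := mem_rotEnds.1 hx
        obtain ⟨ly, hly, hy⟩ := mem_rotEnds.1 hy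
        have hx := hlx.perm.mem_iff.1 (List.mem_of_head? hx)
        have hy := hly.perm.mem_iff.1 (List.mem_of_head? hy)
        match l, this, hx, hy with
        | [], _, hx, _ => simp at hx
        | [z], _, hx, hy => simp at hx hy; exact hxy (hx.trans hy.symm)
      have hp := hl'.isPathList (hL1 a ha)
      have hpl : l'.length = longest H := by rw [hl'.perm.length_eq, hL2 a ha]
      have hla : l'.getLast? = some a := by rw [hl'.getLast?, hL3 a ha]
      have hab : a ≠ b := by
        rintro rfl
        match l', hpl, hlb, hla, hp with
        | [], h, _, _, _ => simp at h; omega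
        | [x], h, _, _, _ => simp at h; omega
        | x :: y :: t, _, h1, h2, hp =>
          simp at h1
          subst h1
          rw [List.getLast?_cons_cons] at h2
          exact (List.nodup_cons.1 hp.2).1 (List.mem_of_getLast? h2)
      rw [mem_boosters]
      refine ⟨by simpa using hab, ?_⟩
      have hle : H ≤ H ⊔ SimpleGraph.fromEdgeSet {s(a, b)} := le_sup_left
      refine (isHamiltonian_or_longest_lt hle hconn hp hpl hlb hla ?_ h3).imp_right
        (progress_lt_of_longest hle)
      exact Or.inr (by simpa using hab)
  · rw [SimpleGraph.Preconnected] at hconn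
    push Not at hconn
    obtain ⟨u, v, huv⟩ := hconn
    -- In a disconnected graph, every pair joining two fixed components is a booster, as it lowers
    -- the number of components.
    refine ⟨(univ.filter fun x => H.Reachable u x) ×ˢ (univ.filter fun x => H.Reachable v x),
      ?_, ?_⟩
    · rw [card_product, sq]
      exact Nat.mul_le_mul (hH.lt_card_component u).le (hH.lt_card_component v).le
    · rintro ⟨a, b⟩ hq
      simp only [mem_product, mem_filter, mem_univ, true_and] at hq
      have hab : ¬ H.Reachable a b := fun h => huv ((hq.1.trans h).trans hq.2.symm)
      have hne : a ≠ b := by rintro rfl; exact hab (SimpleGraph.Reachable.refl _)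
      rw [mem_boosters]
      refine ⟨by simpa using hne, Or.inr (progress_lt_of_not_reachable le_sup_left hab ?_)⟩
      exact Or.inr (by simpa using hne)

end Boosters

end RainbowHamilton

namespace RainbowHamilton

open Finset

/-! ### Random choices from lists, conditioned on being rainbow. -/

section RainbowChoice

variable {S E K : Type*} [DecidableEq S]

lemma injOn_update_iff {c : E → K} {T : Finset S} {t : S} (ht : t ∉ T) (f : S → E) (b : E) :
    Set.InjOn (fun s => c (Function.update f t b s)) T ↔ Set.InjOn (fun s => c (f s)) T := by
  refine Set.EqOn.injOn_iff fun s hs => ?_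
  have : s ≠ t := by rintro rfl; exact ht hs
  simp [this]

variable [Fintype S]

/-- Resampling coordinate `t`: exchanging `f t` with an independent `b ∈ L t` is an involution on
pairs `(f, b)`, and `w` does not see coordinate `t` of its first argument. -/
lemma card_mul_sum_piFinset (L : S → Finset E) (t : S) (w : (S → E) → E → ℕ)
    (hw : ∀ f b a, w (Function.update f t b) a = w f a) :
    (L t).card * ∑ f ∈ Fintype.piFinset L, w f (f t) =
      ∑ f ∈ Fintype.piFinset L, ∑ b ∈ L t, w f b := by
  rw [mul_sum]
  simp_rw [← smul_eq_mul, ← sum_const]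
  rw [← sum_product', ← sum_product']
  refine sum_nbij' (fun q => (Function.update q.1 t q.2, q.1 t))
    (fun q => (Function.update q.1 t q.2, q.1 t)) ?_ ?_ ?_ ?_ ?_
  · rintro ⟨f, b⟩ h
    simp only [mem_product, Fintype.mem_piFinset] at h ⊢
    refine ⟨fun s => ?_, h.1 t⟩
    rcases eq_or_ne s t with rfl | hs
    · simpa using h.2
    · simpa [hs] using h.1 s
  · rintro ⟨f, b⟩ h
    simp only [mem_product, Fintype.mem_piFinset] at h ⊢
    refine ⟨fun s => ?_, h.1 t⟩
    rcases eq_or_ne s t with rfl | hs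
    · simpa using h.2
    · simpa [hs] using h.1 s
  · rintro ⟨f, b⟩ _; simp
  · rintro ⟨f, b⟩ _; simp
  · rintro ⟨f, b⟩ _; simp [hw]

open Classical in
/-- The choices `f` from the lists `L` whose colours on `T` are pairwise distinct. -/
noncomputable def rainbowChoices (L : S → Finset E) (c : E → K) (T : Finset S) :
    Finset (S → E) :=
  (Fintype.piFinset L).filter fun f => Set.InjOn (fun s => c (f s)) T

lemma mem_rainbowChoices {L : S → Finset E} {c : E → K} {T : Finset S} {f : S → E} :
    f ∈ rainbowChoices L c T ↔ (∀ s, f s ∈ L s) ∧ Set.InjOn (fun s => c (f s)) T := by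
  simp [rainbowChoices]

open Classical in
/-- Resampling one coordinate outside of `T`. -/
lemma card_mul_sum_rainbowChoices (L : S → Finset E) (c : E → K) {T : Finset S} {t : S}
    (ht : t ∉ T) (w : (S → E) → E → ℕ) (hw : ∀ f b a, w (Function.update f t b) a = w f a) :
    (L t).card * ∑ f ∈ rainbowChoices L c T, w f (f t) =
      ∑ f ∈ rainbowChoices L c T, ∑ b ∈ L t, w f b := by
  have := card_mul_sum_piFinset L t
    (fun f b => if Set.InjOn (fun s => c (f s)) T then w f b else 0)
    (fun f b a => by simp only [injOn_update_iff ht, hw])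
  simp only [rainbowChoices, sum_filter]
  rw [this]
  refine sum_congr rfl fun f _ => ?_
  split_ifs <;> simp

open Classical in
-- A choice lost on passing from `T` to `insert s T` has `s` agreeing in colour with some `t ∈ T`.
-- Forgetting that `t` is rainbow costs a factor 2 by induction and makes both `s` and `t` free to
-- be resampled. Summed over `t`, the coincidences have relative frequency at most `2M/D ≤ 1/2`.
lemma card_rainbowChoices_le_two_mul {L : S → Finset E} {c : E → K} {M D : ℕ} (hD0 : 0 < D)
    (hD : ∀ s, D ≤ (L s).card) (hMD : 4 * M ≤ D)
    (hM : ∀ k, ∑ t, ((L t).filter fun b => c b = k).card ≤ M) (T : Finset S) :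
    ∀ s ∉ T, (rainbowChoices L c T).card ≤ 2 * (rainbowChoices L c (insert s T)).card := by
  induction T using Finset.strongInduction with
  | H T ih =>
  intro s hs
  set Y : S → Finset (S → E) := fun t =>
    (rainbowChoices L c (T.erase t)).filter fun f => c (f t) = c (f s) with hY
  have hcover : (rainbowChoices L c T).card ≤
      (rainbowChoices L c (insert s T)).card + ∑ t ∈ T, (Y t).card := by
    refine (card_le_card (t := rainbowChoices L c (insert s T) ∪ T.biUnion Y) ?_).trans
      ((card_union_le _ _).trans (Nat.add_le_add_left card_biUnion_le _))
    intro f hf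
    rw [mem_rainbowChoices] at hf
    by_cases h : ∃ t ∈ T, c (f t) = c (f s)
    · obtain ⟨t, ht, htc⟩ := h
      refine mem_union_right _ (mem_biUnion.2 ⟨t, ht, mem_filter.2 ⟨?_, htc⟩⟩)
      exact mem_rainbowChoices.2 ⟨hf.1, hf.2.mono (by simp)⟩
    · push Not at h
      refine mem_union_left _ (mem_rainbowChoices.2 ⟨hf.1, ?_⟩)
      rw [coe_insert, Set.injOn_insert (by simpa using hs)]
      refine ⟨hf.2, ?_⟩
      rintro ⟨t, ht, htc⟩
      exact h t ht htc
  have hYbound : ∀ t ∈ T, D * ((L s).card * (Y t).card) ≤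
      2 * (rainbowChoices L c T).card *
        ∑ a ∈ L s, ((L t).filter fun b => c b = c a).card := by
    intro t ht
    have hts : t ≠ s := by rintro rfl; exact hs ht
    -- First resample `t`, then `s`; neither belongs to `T.erase t`.
    have h1 : (L t).card * (Y t).card = ∑ f ∈ rainbowChoices L c (T.erase t),
        ((L t).filter fun b => c b = c (f s)).card := by
      have := card_mul_sum_rainbowChoices L c (notMem_erase t T)
        (fun f b => if c b = c (f s) then 1 else 0) (fun f b a => by simp [hts.symm])
      rw [hY, card_filter, this]
      exact sum_congr rfl fun f _ => (card_filter _ _).symm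
    have h2 := card_mul_sum_rainbowChoices L c (T := T.erase t) (t := s)
      (fun h => hs (mem_of_mem_erase h))
      (fun _ a => ((L t).filter fun b => c b = c a).card) (fun f b a => rfl)
    rw [sum_const, smul_eq_mul] at h2
    have h3 := ih (T.erase t) (erase_ssubset ht) t (notMem_erase t T)
    rw [insert_erase ht] at h3
    calc D * ((L s).card * (Y t).card) ≤ (L t).card * ((L s).card * (Y t).card) :=
          Nat.mul_le_mul_right _ (hD t)
      _ = (L s).card * ((L t).card * (Y t).card) := by ring
      _ = _ := by rw [h1, h2]
      _ ≤ _ := Nat.mul_le_mul_right _ h3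
  have hsum : D * ((L s).card * ∑ t ∈ T, (Y t).card) ≤
      2 * (rainbowChoices L c T).card * ((L s).card * M) := by
    rw [mul_sum, mul_sum]
    refine (sum_le_sum hYbound).trans ?_
    rw [← mul_sum]
    refine Nat.mul_le_mul_left _ ?_
    rw [sum_comm, ← smul_eq_mul, ← sum_const]
    refine sum_le_sum fun a _ => (sum_le_sum_of_subset (subset_univ T)).trans (hM (c a))
  have hLs : 0 < (L s).card := hD0.trans_le (hD s)
  have hsum' : D * ∑ t ∈ T, (Y t).card ≤ 2 * (rainbowChoices L c T).card * M := by
    refine Nat.le_of_mul_le_mul_left ?_ hLs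
    calc _ = D * ((L s).card * ∑ t ∈ T, (Y t).card) := by ring
      _ ≤ _ := hsum
      _ = _ := by ring
  have : 2 * ∑ t ∈ T, (Y t).card ≤ (rainbowChoices L c T).card := by
    refine Nat.le_of_mul_le_mul_left ?_ hD0
    calc D * (2 * ∑ t ∈ T, (Y t).card) = 2 * (D * ∑ t ∈ T, (Y t).card) := by ring
      _ ≤ 2 * (2 * (rainbowChoices L c T).card * M) := Nat.mul_le_mul_left _ hsum'
      _ = (rainbowChoices L c T).card * (4 * M) := by ring
      _ ≤ (rainbowChoices L c T).card * D := Nat.mul_le_mul_left _ hMD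
      _ = _ := by ring
  omega

open Classical in
lemma card_rainbowChoices_le_two_pow_mul {L : S → Finset E} {c : E → K} {M D : ℕ} (hD0 : 0 < D)
    (hD : ∀ s, D ≤ (L s).card) (hMD : 4 * M ≤ D)
    (hM : ∀ k, ∑ t, ((L t).filter fun b => c b = k).card ≤ M) (T A : Finset S)
    (hTA : Disjoint T A) :
    (rainbowChoices L c T).card ≤ 2 ^ A.card * (rainbowChoices L c (T ∪ A)).card := by
  induction A using Finset.induction_on with
  | empty => simp
  | insert a A ha ih =>
    rw [disjoint_insert_right] at hTA
    refine (ih hTA.2).trans ?_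
    rw [card_insert_of_notMem ha, pow_succ, mul_assoc, union_insert]
    refine Nat.mul_le_mul_left _ (card_rainbowChoices_le_two_mul hD0 hD hMD hM _ _ ?_)
    simp [hTA.1, ha]

open Classical in
-- The rainbow condition on `T` leaves the coordinates in `A` independent and uniform on their
-- lists.
lemma prod_mul_card_filter_rainbowChoices (L : S → Finset E) (c : E → K) (Q : S → Finset E)
    (hQ : ∀ s, Q s ⊆ L s) (T A : Finset S) (hTA : Disjoint T A) :
    (∏ a ∈ A, (L a).card) * ((rainbowChoices L c T).filter fun f => ∀ a ∈ A, f a ∈ Q a).card =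
      (∏ a ∈ A, (Q a).card) * (rainbowChoices L c T).card := by
  induction A using Finset.induction_on with
  | empty => simp
  | insert a A ha ih =>
    rw [disjoint_insert_right] at hTA
    have h := card_mul_sum_rainbowChoices L c hTA.1
      (fun f b => if (∀ a ∈ A, f a ∈ Q a) ∧ b ∈ Q a then 1 else 0) (fun f b x => by
        have : (∀ a' ∈ A, Function.update f a b a' ∈ Q a') ↔ ∀ a' ∈ A, f a' ∈ Q a' := by
          refine forall₂_congr fun a' ha' => ?_
          have : a' ≠ a := by rintro rfl; exact ha ha'
          simp [this]
        simp only [this])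
    have h1 : ∑ f ∈ rainbowChoices L c T,
        (if (∀ a ∈ A, f a ∈ Q a) ∧ f a ∈ Q a then 1 else 0) =
        ((rainbowChoices L c T).filter fun f => ∀ a' ∈ insert a A, f a' ∈ Q a').card := by
      rw [← card_filter]
      congr 1
      refine filter_congr fun f _ => ?_
      rw [forall_mem_insert, and_comm]
    have h2 : ∑ f ∈ rainbowChoices L c T,
        ∑ b ∈ L a, (if (∀ a ∈ A, f a ∈ Q a) ∧ b ∈ Q a then 1 else 0) =
        ((rainbowChoices L c T).filter fun f => ∀ a' ∈ A, f a' ∈ Q a').card * (Q a).card := by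
      rw [card_filter, sum_mul]
      refine sum_congr rfl fun f _ => ?_
      by_cases hf : ∀ a ∈ A, f a ∈ Q a
      · rw [if_pos hf, one_mul]
        have h3 : ∀ b, ((∀ a ∈ A, f a ∈ Q a) ∧ b ∈ Q a) ↔ b ∈ Q a := fun b => and_iff_right hf
        simp only [h3]
        rw [← card_filter, filter_mem_eq_inter, inter_eq_right.2 (hQ a)]
      · simp [hf]
    rw [h1, h2] at h
    rw [prod_insert ha, prod_insert ha, mul_comm (L a).card, mul_assoc, h, ← mul_assoc, ih hTA.2]
    ring

open Classical in
/-- A rainbow choice from large lists can be found that avoids a family of unlikely events, each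
prescribing small target sets on some coordinates. -/
theorem exists_rainbow_choice {J : Type*} {L : S → Finset E} {c : E → K} {M D : ℕ} (hD0 : 0 < D)
    (hD : ∀ s, D ≤ (L s).card) (hMD : 4 * M ≤ D)
    (hM : ∀ k, ∑ t, ((L t).filter fun b => c b = k).card ≤ M)
    (I : Finset J) (A : J → Finset S) (Q : J → S → Finset E) (hQ : ∀ j s, Q j s ⊆ L s)
    (hI : ∑ j ∈ I, ∏ a ∈ A j, (2 * (Q j a).card / (L a).card : ℝ) < 1) :
    ∃ f : S → E, (∀ s, f s ∈ L s) ∧ Function.Injective (fun s => c (f s)) ∧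
      ∀ j ∈ I, ∃ a ∈ A j, f a ∉ Q j a := by
  have hL : ∀ s, 0 < ((L s).card : ℝ) := fun s => by exact_mod_cast hD0.trans_le (hD s)
  have hpos : 0 < (rainbowChoices L c univ).card := by
    have h := card_rainbowChoices_le_two_pow_mul hD0 hD hMD hM ∅ univ (disjoint_empty_left _)
    have h0 : 0 < (rainbowChoices L c (∅ : Finset S)).card := by
      have : rainbowChoices L c (∅ : Finset S) = Fintype.piFinset L := by
        ext f; simp [mem_rainbowChoices]
      rw [this, Fintype.card_piFinset]
      exact prod_pos fun s _ => hD0.trans_le (hD s)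
    rw [empty_union] at h
    exact Nat.pos_of_mul_pos_left (h0.trans_le h)
  have hbad : ∀ j, (((rainbowChoices L c univ).filter fun f => ∀ a ∈ A j, f a ∈ Q j a).card : ℝ) ≤
      (∏ a ∈ A j, (2 * (Q j a).card / (L a).card : ℝ)) * (rainbowChoices L c univ).card := by
    intro j
    -- Dropping the rainbow condition on `A j` makes the event a product; restoring it in the
    -- normalisation costs `2 ^ (A j).card`.
    have h1 : ((rainbowChoices L c univ).filter fun f => ∀ a ∈ A j, f a ∈ Q j a).card ≤
        ((rainbowChoices L c (A j)ᶜ).filter fun f => ∀ a ∈ A j, f a ∈ Q j a).card := by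
      refine card_le_card (filter_subset_filter _ fun f hf => ?_)
      rw [mem_rainbowChoices] at hf ⊢
      exact ⟨hf.1, hf.2.mono (by simp)⟩
    have h2 := prod_mul_card_filter_rainbowChoices L c (Q j) (hQ j) (A j)ᶜ (A j)
      disjoint_compl_left
    have h3 := card_rainbowChoices_le_two_pow_mul hD0 hD hMD hM (A j)ᶜ (A j) disjoint_compl_left
    rw [union_comm, union_compl] at h3
    have hP : 0 < ∏ a ∈ A j, ((L a).card : ℝ) := prod_pos fun a _ => hL a
    rw [prod_div_distrib, prod_mul_distrib, prod_const, div_mul_eq_mul_div, le_div_iff₀ hP]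
    have h1' : (((rainbowChoices L c univ).filter fun f => ∀ a ∈ A j, f a ∈ Q j a).card : ℝ) ≤
        (((rainbowChoices L c (A j)ᶜ).filter fun f => ∀ a ∈ A j, f a ∈ Q j a).card : ℝ) := by
      exact_mod_cast h1
    have h2' : (∏ a ∈ A j, ((L a).card : ℝ)) *
        (((rainbowChoices L c (A j)ᶜ).filter fun f => ∀ a ∈ A j, f a ∈ Q j a).card : ℝ) =
        (∏ a ∈ A j, ((Q j a).card : ℝ)) * ((rainbowChoices L c (A j)ᶜ).card : ℝ) := by
      exact_mod_cast h2
    have h3' : ((rainbowChoices L c (A j)ᶜ).card : ℝ) ≤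
        2 ^ (A j).card * ((rainbowChoices L c univ).card : ℝ) := by exact_mod_cast h3
    calc _ ≤ (((rainbowChoices L c (A j)ᶜ).filter fun f => ∀ a ∈ A j, f a ∈ Q j a).card : ℝ) *
          ∏ a ∈ A j, ((L a).card : ℝ) := by gcongr
      _ = (∏ a ∈ A j, ((Q j a).card : ℝ)) * ((rainbowChoices L c (A j)ᶜ).card : ℝ) := by
        rw [mul_comm, h2']
      _ ≤ (∏ a ∈ A j, ((Q j a).card : ℝ)) *
          (2 ^ (A j).card * ((rainbowChoices L c univ).card : ℝ)) := by gcongr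
      _ = _ := by ring
  have hlt : (((I.biUnion fun j => (rainbowChoices L c univ).filter
      fun f => ∀ a ∈ A j, f a ∈ Q j a)).card : ℝ) < (rainbowChoices L c univ).card := by
    have hpos' : 0 < ((rainbowChoices L c univ).card : ℝ) := by exact_mod_cast hpos
    calc _ ≤ ∑ j ∈ I, (((rainbowChoices L c univ).filter
          fun f => ∀ a ∈ A j, f a ∈ Q j a).card : ℝ) := by exact_mod_cast card_biUnion_le
      _ ≤ ∑ j ∈ I, (∏ a ∈ A j, (2 * (Q j a).card / (L a).card : ℝ)) *
          (rainbowChoices L c univ).card := sum_le_sum fun j _ => hbad j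
      _ < _ := by rw [← sum_mul]; nlinarith
  obtain ⟨f, hf, hfb⟩ := exists_mem_notMem_of_card_lt_card (by exact_mod_cast hlt)
  have hf' := mem_rainbowChoices.1 hf
  refine ⟨f, hf'.1, ?_, fun j hj => ?_⟩
  · rw [← Set.injOn_univ]
    simpa using hf'.2
  · by_contra! hcon
    exact hfb (mem_biUnion.2 ⟨j, hj, mem_filter.2 ⟨hf, hcon⟩⟩)

end RainbowChoice

end RainbowHamilton

namespace RainbowHamilton

open Finset

/-! ### Estimates for union bounds over vertex sets. -/

section Counting

/-- A form of the AM-GM inequality, from `t ≤ exp (t - 1)` with `t = y i / q`. -/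
lemma prod_le_pow_card_of_sum_le {ι : Type*} (X : Finset ι) (y : ι → ℝ) (hy : ∀ i ∈ X, 0 ≤ y i)
    {q : ℝ} (hq : 0 < q) (h : ∑ i ∈ X, y i ≤ X.card * q) : ∏ i ∈ X, y i ≤ q ^ X.card := by
  have h1 : ∏ i ∈ X, y i / q ≤ 1 := by
    calc ∏ i ∈ X, y i / q ≤ ∏ i ∈ X, Real.exp (y i / q - 1) := by
          refine prod_le_prod (fun i hi => div_nonneg (hy i hi) hq.le) fun i _ => ?_
          have := Real.add_one_le_exp (y i / q - 1)
          linarith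
      _ = Real.exp ((∑ i ∈ X, y i) / q - X.card) := by
          rw [← Real.exp_sum, sum_sub_distrib, sum_div, sum_const, nsmul_eq_mul, mul_one]
      _ ≤ 1 := by
          rw [Real.exp_le_one_iff, sub_nonpos, div_le_iff₀ hq]
          exact h
  rwa [prod_div_distrib, prod_const, div_le_one (pow_pos hq _)] at h1

lemma choose_mul_pow_le_one {n : ℕ} (hn : 0 < n) (z : ℕ) :
    (n.choose z : ℝ) * ((z : ℝ) / (3 * n)) ^ z ≤ 1 := by
  have hn' : (0 : ℝ) < n := by exact_mod_cast hn
  have h1 : (n.choose z : ℝ) ≤ (n : ℝ) ^ z / (z.factorial : ℝ) := Nat.choose_le_pow_div z n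
  have h2 := Real.pow_div_factorial_le_exp (z : ℝ) (Nat.cast_nonneg z) z
  have h3 : Real.exp z ≤ 3 ^ z := by
    rw [← mul_one (z : ℝ), Real.exp_nat_mul]
    exact pow_le_pow_left₀ (Real.exp_pos 1).le
      (Real.exp_one_lt_d9.le.trans (by norm_num)) z
  calc (n.choose z : ℝ) * ((z : ℝ) / (3 * n)) ^ z
      ≤ (n : ℝ) ^ z / (z.factorial : ℝ) * ((z : ℝ) / (3 * n)) ^ z := by gcongr
    _ = (z : ℝ) ^ z / (z.factorial : ℝ) / 3 ^ z := by
        rw [div_pow, mul_pow]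
        field_simp
    _ ≤ 1 := by
        rw [div_le_one (by positivity)]
        exact h2.trans h3

/-- The factor `z/(3n)` pays for the choice of a `z`-set, since `n.choose z ≤ (3n/z)^z`. What
remains is a geometric series. All later union bounds over vertex sets are brought to this form. -/
lemma sum_nonempty_pow_le {V : Type*} [Fintype V] [Nonempty V] {q : ℝ} (hq0 : 0 ≤ q)
    (hq1 : q < 1) :
    ∑ Z ∈ univ.filter (fun Z : Finset V => Z.Nonempty),
      (q * ((Z.card : ℝ) / (3 * Fintype.card V))) ^ Z.card ≤ q / (1 - q) := by
  set g : ℕ → ℝ := fun z => if z = 0 then 0 else (q * ((z : ℝ) / (3 * Fintype.card V))) ^ z with hg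
  have h1 : ∑ Z ∈ univ.filter (fun Z : Finset V => Z.Nonempty),
      (q * ((Z.card : ℝ) / (3 * Fintype.card V))) ^ Z.card =
      ∑ Z ∈ (univ : Finset V).powerset, g Z.card := by
    rw [powerset_univ, sum_filter]
    refine sum_congr rfl fun Z _ => ?_
    by_cases hZ : Z.Nonempty
    · rw [if_pos hZ, hg]
      simp only [hZ.card_pos.ne', if_false]
    · rw [if_neg hZ, hg, not_nonempty_iff_eq_empty.1 hZ]
      simp
  rw [h1, sum_powerset_apply_card, card_univ]
  have h2 : ∀ z ∈ range (Fintype.card V + 1), (Fintype.card V).choose z • g z ≤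
      if z = 0 then 0 else q ^ z := by
    intro z _
    rw [hg]
    by_cases hz : z = 0
    · simp [hz]
    · simp only [hz, if_false, nsmul_eq_mul]
      rw [mul_pow, mul_left_comm]
      exact mul_le_of_le_one_right (pow_nonneg hq0 z) (choose_mul_pow_le_one Fintype.card_pos z)
  refine (sum_le_sum h2).trans ?_
  rw [sum_range_succ']
  simp only [Nat.add_eq_zero_iff, one_ne_zero, and_false, if_false, if_true, add_zero, pow_succ]
  rw [← sum_mul, div_eq_inv_mul]
  refine mul_le_mul_of_nonneg_right ?_ hq0
  rw [← tsum_geometric_of_lt_one hq0 hq1]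
  exact (summable_geometric_of_lt_one hq0 hq1).sum_le_tsum _ fun i _ => pow_nonneg hq0 i

lemma sum_card_filter_mem_le {V : Type*} [DecidableEq V] (W : Finset (Sym2 V)) (X : Finset V) :
    ∑ x ∈ X, (W.filter fun e => x ∈ e).card ≤ 2 * W.card := by
  simp_rw [card_filter]
  rw [sum_comm, mul_comm, ← smul_eq_mul, ← sum_const]
  refine sum_le_sum fun e _ => ?_
  rw [← card_filter]
  refine (card_le_card (t := e.toFinset) fun x hx => ?_).trans ?_
  · simpa using (mem_filter.1 hx).2
  · rw [Sym2.card_toFinset]; split_ifs <;> omega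

end Counting

/-! ### Rainbow expanders and their completion by boosters. -/

section Deterministic

/-- The graph with edge set `F`. -/
abbrev graphOf {V : Type*} (F : Finset (Sym2 V)) : SimpleGraph V :=
  SimpleGraph.fromEdgeSet (F : Set (Sym2 V))

lemma graphOf_insert {V : Type*} [DecidableEq V] (F : Finset (Sym2 V)) (e : Sym2 V) :
    graphOf (insert e F) = graphOf F ⊔ SimpleGraph.fromEdgeSet {e} := by
  rw [graphOf, coe_insert, Set.insert_eq, Set.union_comm, SimpleGraph.fromEdgeSet_union]

variable {V : Type*} [Fintype V] [DecidableEq V] {K : Type*}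

open Classical in
/-- A sparse-on-small-sets graph of large minimum degree with few edges of each colour contains a
rainbow expander with linearly many edges. -/
theorem exists_rainbow_expander [Nonempty V] {E : Finset (Sym2 V)} (hE : ∀ e ∈ E, ¬ e.IsDiag)
    {c : Sym2 V → K} {D M s : ℕ} (hD0 : 0 < D)
    (hD : ∀ v, D ≤ (E.filter fun e => v ∈ e).card) (hMD : 128 * M ≤ D)
    (hM : ∀ k, (E.filter fun e => c e = k).card ≤ M) (small : ℕ → Prop)
    (hsmall : ∀ Z : Finset V, Z.Nonempty → small Z.card → (E ∩ Z.sym2).card < 4 * Z.card)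
    (hmed : ∀ Z : Finset V, Z.Nonempty → ¬ small Z.card → Z.card < 4 * s →
      ((E ∩ Z.sym2).card : ℝ) ≤ D * Z.card * √((Z.card : ℝ) / Fintype.card V) / 32) :
    ∃ F ⊆ E, Set.InjOn c F ∧ F.card ≤ 16 * Fintype.card V ∧ IsExpander (graphOf F) s := by
  set L : V × Fin 16 → Finset (Sym2 V) := fun a => E.filter fun e => a.1 ∈ e with hL
  -- The bad event for `(X, Z)` is that all 16 choices of every vertex of `X` fall inside `Z`;
  -- failure of expansion at `X` forces it for `Z = X ∪ N(X)`.
  set I : Finset (Finset V × Finset V) := univ.filter fun j => j.1 ⊆ j.2 ∧ j.1.Nonempty ∧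
    j.1.card ≤ s ∧ j.2.card < 4 * j.1.card ∧ ¬ small j.2.card with hI
  have hn : (0 : ℝ) < Fintype.card V := by exact_mod_cast Fintype.card_pos
  have hD' : (0 : ℝ) < D := by exact_mod_cast hD0
  have hterm : ∀ j ∈ I, ∏ a ∈ j.1 ×ˢ (univ : Finset (Fin 16)),
      (2 * (L a ∩ j.2.sym2).card / (L a).card : ℝ) ≤
      (((j.2.card : ℝ) / Fintype.card V) ^ 2 / 16) ^ j.2.card := by
    rintro ⟨X, Z⟩ hj
    simp only [hI, mem_filter, mem_univ, true_and] at hj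
    obtain ⟨hXZ, hX, hXs, hZX, hZsm⟩ := hj
    have hZ : Z.Nonempty := hX.mono hXZ
    have hz : (0 : ℝ) < Z.card := by exact_mod_cast hZ.card_pos
    have hx : (0 : ℝ) < (Z.card : ℝ) / Fintype.card V := by positivity
    have hx1 : (Z.card : ℝ) / Fintype.card V ≤ 1 := by
      rw [div_le_one hn]; exact_mod_cast card_le_univ Z
    have hsq0 : 0 < √((Z.card : ℝ) / Fintype.card V) := Real.sqrt_pos.2 hx
    have hsq1 : √((Z.card : ℝ) / Fintype.card V) ≤ 1 := Real.sqrt_le_one.2 hx1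
    have hsum : ∑ x ∈ X, (2 * ((E ∩ Z.sym2).filter fun e => x ∈ e).card / D : ℝ) ≤
        X.card * (√((Z.card : ℝ) / Fintype.card V) / 2) := by
      rw [← sum_div, ← mul_sum, div_le_iff₀ hD']
      have h1 : (∑ x ∈ X, (((E ∩ Z.sym2).filter fun e => x ∈ e).card : ℝ)) ≤
          2 * (E ∩ Z.sym2).card := by
        exact_mod_cast sum_card_filter_mem_le (E ∩ Z.sym2) X
      have h2 := hmed Z hZ hZsm (hZX.trans_le (Nat.mul_le_mul_left 4 hXs))
      have h3 : (Z.card : ℝ) ≤ 4 * X.card := by exact_mod_cast hZX.le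
      have h4 : D * √((Z.card : ℝ) / Fintype.card V) * Z.card ≤
          D * √((Z.card : ℝ) / Fintype.card V) * (4 * X.card) := by gcongr
      nlinarith
    have hprod := prod_le_pow_card_of_sum_le X _ (fun x _ => by positivity) (by positivity) hsum
    have hXZ4 : Z.card ≤ 4 * X.card := hZX.le
    calc ∏ a ∈ X ×ˢ (univ : Finset (Fin 16)), (2 * (L a ∩ Z.sym2).card / (L a).card : ℝ)
        ≤ ∏ a ∈ X ×ˢ (univ : Finset (Fin 16)),
          (2 * ((E ∩ Z.sym2).filter fun e => a.1 ∈ e).card / D : ℝ) := by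
          refine prod_le_prod (fun a _ => by positivity) fun a _ => ?_
          have h1 : (D : ℝ) ≤ (L a).card := by exact_mod_cast hD a.1
          have h2 : L a ∩ Z.sym2 = (E ∩ Z.sym2).filter fun e => a.1 ∈ e := by
            ext e; simp only [hL, mem_inter, mem_filter]; tauto
          rw [h2]
          gcongr
      _ = (∏ x ∈ X, (2 * ((E ∩ Z.sym2).filter fun e => x ∈ e).card / D : ℝ)) ^ 16 := by
          rw [prod_product, ← prod_pow]
          exact prod_congr rfl fun x _ => by simp only [prod_const, card_univ, Fintype.card_fin]
      _ ≤ ((√((Z.card : ℝ) / Fintype.card V) / 2) ^ X.card) ^ 16 :=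
          pow_le_pow_left₀ (prod_nonneg fun x _ => by positivity) hprod 16
      -- Sixteen choices per vertex and `|Z| ≤ 4|X|` leave a fourth power for each vertex of `Z`,
      -- which beats both the number of `Z` and the `2^|Z|` subsets `X`.
      _ = ((√((Z.card : ℝ) / Fintype.card V) / 2) ^ 4) ^ (4 * X.card) := by
          rw [← pow_mul, ← pow_mul]; congr 1; ring
      _ ≤ ((√((Z.card : ℝ) / Fintype.card V) / 2) ^ 4) ^ Z.card :=
          pow_le_pow_of_le_one (by positivity) (pow_le_one₀ (by positivity) (by linarith)) hXZ4
      _ = _ := by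
          congr 1
          rw [div_pow, show (4 : ℕ) = 2 * 2 by rfl, pow_mul, Real.sq_sqrt hx.le]
          norm_num
  have hlt : ∑ j ∈ I, ∏ a ∈ j.1 ×ˢ (univ : Finset (Fin 16)),
      (2 * (L a ∩ j.2.sym2).card / (L a).card : ℝ) < 1 := by
    have hsub : I ⊆ ((univ.filter fun Z : Finset V => Z.Nonempty).sigma
        fun Z => Z.powerset).image fun q => (q.2, q.1) := by
      rintro ⟨X, Z⟩ hj
      simp only [hI, mem_filter, mem_univ, true_and] at hj
      refine mem_image.2 ⟨⟨Z, X⟩, ?_, rfl⟩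
      simp only [mem_sigma, mem_filter, mem_univ, true_and, mem_powerset]
      exact ⟨hj.2.1.mono hj.1, hj.1⟩
    calc _ ≤ ∑ j ∈ I, (((j.2.card : ℝ) / Fintype.card V) ^ 2 / 16) ^ j.2.card := sum_le_sum hterm
      _ ≤ ∑ j ∈ ((univ.filter fun Z : Finset V => Z.Nonempty).sigma
        fun Z => Z.powerset).image fun q => (q.2, q.1),
          (((j.2.card : ℝ) / Fintype.card V) ^ 2 / 16) ^ j.2.card :=
          sum_le_sum_of_subset_of_nonneg hsub fun _ _ _ => by positivity
      _ = ∑ Z ∈ univ.filter (fun Z : Finset V => Z.Nonempty), ∑ X ∈ Z.powerset,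
          (((Z.card : ℝ) / Fintype.card V) ^ 2 / 16) ^ Z.card := by
          rw [sum_image, sum_sigma]
          rintro ⟨a, b⟩ _ ⟨a', b'⟩ _ h
          simp only [Prod.mk.injEq] at h
          obtain ⟨rfl, rfl⟩ := h
          rfl
      _ ≤ ∑ Z ∈ univ.filter (fun Z : Finset V => Z.Nonempty),
          ((3 / 8 : ℝ) * ((Z.card : ℝ) / (3 * Fintype.card V))) ^ Z.card := by
          refine sum_le_sum fun Z _ => ?_
          rw [sum_const, card_powerset, nsmul_eq_mul, Nat.cast_pow, ← mul_pow]
          refine pow_le_pow_left₀ (by positivity) ?_ _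
          have hx1 : (Z.card : ℝ) / Fintype.card V ≤ 1 := by
            rw [div_le_one hn]; exact_mod_cast card_le_univ Z
          have hx0 : 0 ≤ (Z.card : ℝ) / Fintype.card V := by positivity
          have : (Z.card : ℝ) / (3 * Fintype.card V) = (Z.card : ℝ) / Fintype.card V / 3 := by
            field_simp
          rw [this]
          push_cast
          nlinarith
      _ ≤ (3 / 8 : ℝ) / (1 - 3 / 8) := sum_nonempty_pow_le (by norm_num) (by norm_num)
      _ < 1 := by norm_num
  -- An edge occurs in the 16 lists at each of its two ends, hence the colour bound `32 * M`.
  obtain ⟨f, hfL, hfinj, hfI⟩ := exists_rainbow_choice (L := L) (c := c) (M := 32 * M) hD0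
    (fun a => hD a.1) (by omega) (fun k => by
      rw [Fintype.sum_prod_type]
      calc _ = ∑ v : V, 16 * ((E.filter fun e => c e = k).filter fun e => v ∈ e).card := by
            refine sum_congr rfl fun v _ => ?_
            simp only [hL]
            rw [sum_const, card_univ, Fintype.card_fin, smul_eq_mul, filter_comm]
        _ ≤ 32 * M := by
            rw [← mul_sum]
            have h1 := sum_card_filter_mem_le (E.filter fun e => c e = k) univ
            have h2 := hM k
            omega)
    I (fun j => j.1 ×ˢ univ) (fun j a => L a ∩ j.2.sym2) (fun j a => inter_subset_left) hlt
  have hfE : ∀ a, f a ∈ E ∧ a.1 ∈ f a := fun a => mem_filter.1 (hfL a)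
  refine ⟨univ.image f, ?_, ?_, ?_, ?_⟩
  · intro e he
    obtain ⟨a, _, rfl⟩ := mem_image.1 he
    exact (hfE a).1
  · rintro e he e' he' hee
    obtain ⟨a, _, rfl⟩ := mem_image.1 (mem_coe.1 he)
    obtain ⟨a', _, rfl⟩ := mem_image.1 (mem_coe.1 he')
    rw [hfinj hee]
  · refine card_image_le.trans ?_
    rw [card_univ, Fintype.card_prod, Fintype.card_fin, mul_comm]
  · intro X hX hXs
    by_contra! hlt4
    set Z := X ∪ nbhd (graphOf (univ.image f)) X with hZdef
    have hXZ : X ⊆ Z := subset_union_left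
    have hin : ∀ x ∈ X, ∀ i, f (x, i) ∈ Z.sym2 := by
      intro x hx i
      obtain ⟨h1, h2⟩ := hfE (x, i)
      obtain ⟨y, hy⟩ := Sym2.mem_iff_exists.1 h2
      have hxy : x ≠ y := by
        rintro rfl
        exact hE _ h1 (by rw [hy]; exact rfl)
      rw [mem_sym2_iff]
      intro a ha
      rw [hy, Sym2.mem_iff] at ha
      rcases ha with rfl | rfl
      · exact hXZ hx
      · refine mem_union_right _ (mem_nbhd.2 ⟨x, hx, ?_⟩)
        rw [SimpleGraph.fromEdgeSet_adj]
        exact ⟨mem_coe.2 (mem_image.2 ⟨(x, i), mem_univ _, hy⟩), hxy⟩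
    by_cases hsm : small Z.card
    -- The `16|X|` chosen edges are distinct, having distinct colours, but a small `Z` spans fewer
    -- than `4|Z| < 16|X|` edges.
    · have h1 := hsmall Z (hX.mono hXZ) hsm
      have h2 : (X ×ˢ (univ : Finset (Fin 16))).card ≤ (E ∩ Z.sym2).card := by
        refine card_le_card_of_injOn f ?_ ?_
        · rintro ⟨x, i⟩ hxi
          exact mem_coe.2 (mem_inter.2 ⟨(hfE _).1, hin x (by simpa using hxi) i⟩)
        · intro a _ b _ hab
          exact hfinj (congrArg c hab)
      rw [card_product, card_univ, Fintype.card_fin] at h2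
      omega
    · obtain ⟨⟨x, i⟩, ha, hfa⟩ := hfI (X, Z) (by
        simp only [hI, mem_filter, mem_univ, true_and]
        exact ⟨hXZ, hX, hXs, hlt4, hsm⟩)
      exact hfa (mem_inter.2 ⟨hfL _, hin x (by simpa using ha) i⟩)

open Classical in
/-- A rainbow expander can be completed to a rainbow Hamiltonian subgraph by adding boosters. -/
theorem exists_rainbow_isHamiltonian {E F₀ : Finset (Sym2 V)} {c : Sym2 V → K} {M s : ℕ}
    (hs : 1 ≤ s) (h3 : 3 ≤ Fintype.card V)
    (hM : ∀ k, (E.filter fun e => c e = k).card ≤ M)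
    (hF₀ : F₀ ⊆ E) (hcF₀ : Set.InjOn c F₀) (hF₀c : F₀.card ≤ 16 * Fintype.card V)
    (hF₀s : IsExpander (graphOf F₀) s)
    (hB : ∀ F ⊆ E, F.card ≤ 18 * Fintype.card V → s ^ 2 ≤ 2 * (boosters (graphOf F) \ F).card →
      18 * Fintype.card V * M < ((boosters (graphOf F) \ F) ∩ E).card) :
    ∃ F ⊆ E, Set.InjOn c F ∧ (graphOf F).IsHamiltonian := by
  by_contra! hcon
  -- The size budget grows with `progress`, so adding a booster that raises `progress` stays in the
  -- family; since `progress ≤ 2n`, sizes stay below `18n`.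
  set 𝓕 := E.powerset.filter fun F => F₀ ⊆ F ∧ Set.InjOn c F ∧
    F.card ≤ 16 * Fintype.card V + progress (graphOf F) with h𝓕
  obtain ⟨F, hF, hmax⟩ := exists_max_image 𝓕 card ⟨F₀, by
    simp only [h𝓕, mem_filter, mem_powerset]
    exact ⟨hF₀, Subset.rfl, hcF₀, hF₀c.trans (Nat.le_add_right _ _)⟩⟩
  simp only [h𝓕, mem_filter, mem_powerset] at hF
  obtain ⟨hFE, hFF, hcF, hFcard⟩ := hF
  have hHam := hcon F hFE hcF
  have hexp : IsExpander (graphOf F) s :=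
    hF₀s.mono (SimpleGraph.fromEdgeSet_mono (coe_subset.2 hFF))
  have hF18 : F.card ≤ 18 * Fintype.card V := by
    have := progress_le (graphOf F); omega
  have hdisj : boosters (graphOf F) \ F = boosters (graphOf F) := by
    rw [Finset.sdiff_eq_self_iff_disjoint, disjoint_left]
    intro e he heF
    have := (mem_boosters.1 he).2
    rw [← graphOf_insert, insert_eq_of_mem heF] at this
    exact this.elim hHam (lt_irrefl _)
  have h1 := hB F hFE hF18 (by rw [hdisj]; exact hexp.sq_le_card_boosters hs h3)
  have h2 : (E.filter fun e => c e ∈ F.image c).card ≤ 18 * Fintype.card V * M := by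
    calc _ ≤ ((F.image c).biUnion fun k => E.filter fun e => c e = k).card := by
          refine card_le_card fun e he => ?_
          rw [mem_filter] at he
          exact mem_biUnion.2 ⟨c e, he.2, mem_filter.2 ⟨he.1, rfl⟩⟩
      _ ≤ ∑ k ∈ F.image c, M := card_biUnion_le.trans (sum_le_sum fun k _ => hM k)
      _ ≤ _ := by
          rw [sum_const, smul_eq_mul]
          exact Nat.mul_le_mul_right _ (card_image_le.trans hF18)
  obtain ⟨e, he, hec⟩ := exists_mem_notMem_of_card_lt_card (h2.trans_lt h1)
  obtain ⟨heB, heE⟩ := mem_inter.1 he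
  obtain ⟨heB, heF⟩ := mem_sdiff.1 heB
  have hce : c e ∉ F.image c := fun h => hec (mem_filter.2 ⟨heE, h⟩)
  have hins : insert e F ⊆ E := insert_subset heE hFE
  have hcins : Set.InjOn c (insert e F : Finset (Sym2 V)) := by
    rw [coe_insert, Set.injOn_insert (by simpa using heF)]
    refine ⟨hcF, ?_⟩
    rintro ⟨e', he', h⟩
    exact hce (mem_image.2 ⟨e', mem_coe.1 he', h⟩)
  rcases (mem_boosters.1 heB).2 with h | h
  · rw [← graphOf_insert] at h
    exact hcon _ hins hcins h
  · rw [← graphOf_insert] at h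
    have := hmax (insert e F) (by
      simp only [h𝓕, mem_filter, mem_powerset]
      refine ⟨hins, hFF.trans (subset_insert _ _), hcins, ?_⟩
      rw [card_insert_of_notMem heF]
      omega)
    rw [card_insert_of_notMem heF] at this
    omega

end Deterministic

end RainbowHamilton

namespace RainbowHamilton

open Finset

/-! ### Finite binomial probabilities and Chernoff bounds. -/

section BinomialWeights

/-- Rankin's trick: for sets of size at most `M`, the factor `y⁻¹ ^ M * y ^ H.card` is at least 1,
and the unrestricted sum factorises. -/
lemma sum_pow_card_le {α : Type*} {p y : ℝ} (h0 : 0 ≤ p) (hy0 : 0 < y) (hy1 : y ≤ 1) (U : Finset α) (M : ℕ) :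
    ∑ H ∈ U.powerset.filter (fun H => H.card ≤ M), p ^ H.card ≤
      y⁻¹ ^ M * Real.exp (p * y * U.card) := by
  calc _ ≤ ∑ H ∈ U.powerset.filter (fun H => H.card ≤ M), y⁻¹ ^ M * (p * y) ^ H.card := by
        refine sum_le_sum fun H hH => ?_
        have hM := (mem_filter.1 hH).2
        have h2 : 1 ≤ y⁻¹ ^ M * y ^ H.card := by
          rw [inv_pow, ← div_eq_inv_mul, one_le_div (pow_pos hy0 _)]
          exact pow_le_pow_of_le_one hy0.le hy1 hM
        rw [mul_pow, mul_left_comm]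
        exact le_mul_of_one_le_right (pow_nonneg h0 _) h2
    _ ≤ ∑ H ∈ U.powerset, y⁻¹ ^ M * (p * y) ^ H.card :=
        sum_le_sum_of_subset_of_nonneg (filter_subset _ _) fun H _ _ => by positivity
    _ = y⁻¹ ^ M * (p * y + 1) ^ U.card := by
        rw [← mul_sum, ← sum_pow_mul_eq_add_pow]
        simp
    _ ≤ _ := by
        rw [mul_comm (p * y) (U.card : ℝ), Real.exp_nat_mul]
        have := Real.add_one_le_exp (p * y)
        gcongr

variable {α : Type*} [DecidableEq α]

/-- The probability that a `p`-random subset of `U` equals `F`. -/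
def bernWeight (p : ℝ) (U F : Finset α) : ℝ := p ^ F.card * (1 - p) ^ (U \ F).card

lemma bernWeight_nonneg {p : ℝ} (h0 : 0 ≤ p) (h1 : p ≤ 1) (U F : Finset α) :
    0 ≤ bernWeight p U F :=
  mul_nonneg (pow_nonneg h0 _) (pow_nonneg (by linarith) _)

open Classical in
/-- The probability that a `p`-random subset of `U` satisfies `P`. -/
noncomputable def bernProb (p : ℝ) (U : Finset α) (P : Finset α → Prop) : ℝ :=
  ∑ F ∈ U.powerset.filter P, bernWeight p U F

/-- Independence of the elements, in generating-function form; both Chernoff bounds are obtained by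
choosing `g` and `h`. -/
lemma sum_bernWeight_mul (p : ℝ) (U : Finset α) (g h : α → ℝ) :
    ∑ F ∈ U.powerset, bernWeight p U F * ((∏ e ∈ F, g e) * ∏ e ∈ U \ F, h e) =
      ∏ e ∈ U, (p * g e + (1 - p) * h e) := by
  rw [prod_add]
  refine sum_congr rfl fun F _ => ?_
  rw [bernWeight, prod_mul_distrib, prod_mul_distrib, prod_const, prod_const]
  ring

lemma bernProb_le_sum {p : ℝ} (h0 : 0 ≤ p) (h1 : p ≤ 1) (U : Finset α) {P : Finset α → Prop}
    (f : Finset α → ℝ) (hf : ∀ F ⊆ U, 0 ≤ f F) (hP : ∀ F ⊆ U, P F → 1 ≤ f F) :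
    bernProb p U P ≤ ∑ F ∈ U.powerset, bernWeight p U F * f F := by
  classical
  rw [bernProb, sum_filter]
  refine sum_le_sum fun F hF => ?_
  rw [mem_powerset] at hF
  have hw := bernWeight_nonneg h0 h1 U F
  split_ifs with h
  · nlinarith [hP F hF h]
  · exact mul_nonneg hw (hf F hF)

lemma bernProb_mono {p : ℝ} (h0 : 0 ≤ p) (h1 : p ≤ 1) {U : Finset α} {P Q : Finset α → Prop}
    (h : ∀ F ⊆ U, P F → Q F) : bernProb p U P ≤ bernProb p U Q := by
  classical
  refine sum_le_sum_of_subset_of_nonneg (fun F hF => ?_) fun F _ _ => bernWeight_nonneg h0 h1 U F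
  rw [mem_filter, mem_powerset] at hF ⊢
  exact ⟨hF.1, h F hF.1 hF.2⟩

lemma bernProb_or_le {p : ℝ} (h0 : 0 ≤ p) (h1 : p ≤ 1) (U : Finset α) (P Q : Finset α → Prop) :
    bernProb p U (fun F => P F ∨ Q F) ≤ bernProb p U P + bernProb p U Q := by
  classical
  calc _ ≤ ∑ F ∈ U.powerset, bernWeight p U F *
        ((if P F then 1 else 0) + (if Q F then 1 else 0)) := by
        refine bernProb_le_sum h0 h1 U _ (fun F _ => by positivity) fun F _ h => ?_
        rcases h with h | h <;> simp only [h, if_true] <;> split_ifs <;> norm_num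
    _ = _ := by
        simp_rw [mul_add, sum_add_distrib, mul_ite, mul_one, mul_zero]
        rw [bernProb, bernProb, sum_filter, sum_filter]

lemma bernProb_exists_le {p : ℝ} (h0 : 0 ≤ p) (h1 : p ≤ 1) (U : Finset α) {J : Type*}
    (I : Finset J) (P : J → Finset α → Prop) :
    bernProb p U (fun F => ∃ j ∈ I, P j F) ≤ ∑ j ∈ I, bernProb p U (P j) := by
  classical
  calc _ ≤ ∑ F ∈ U.powerset, bernWeight p U F * ∑ j ∈ I, (if P j F then 1 else 0) := by
        refine bernProb_le_sum h0 h1 U _ (fun F _ => sum_nonneg fun j _ => by split_ifs <;> simp) ?_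
        rintro F _ ⟨j, hj, hP⟩
        have := single_le_sum (f := fun j => if P j F then (1 : ℝ) else 0)
          (fun j _ => by positivity) hj
        simpa [hP] using this
    _ = _ := by
        simp_rw [mul_sum]
        rw [sum_comm]
        refine sum_congr rfl fun j _ => ?_
        rw [bernProb, sum_filter]
        refine sum_congr rfl fun F _ => ?_
        split_ifs <;> simp

/-- Chernoff bound for the lower tail, jointly with the containment of a disjoint set. -/
lemma bernProb_lower_tail {p : ℝ} (h0 : 0 ≤ p) (h1 : p ≤ 1) {U H B : Finset α} (hH : H ⊆ U)
    (hB : B ⊆ U) (hHB : Disjoint B H) :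
    bernProb p U (fun F => H ⊆ F ∧ ((B ∩ F).card : ℝ) ≤ B.card * p / 4) ≤
      p ^ H.card * Real.exp (-(B.card * p / 4)) := by
  -- Weight `exp (-1)` penalises the elements of `B` that are present; weight 0 on absent elements
  -- of `H` enforces `H ⊆ F`.
  set g : α → ℝ := fun e => if e ∈ B then Real.exp (-1) else 1 with hg
  set h : α → ℝ := fun e => if e ∈ H then 0 else 1 with hh
  have hg0 : ∀ e, 0 ≤ g e := fun e => by
    simp only [hg]; split_ifs; exacts [(Real.exp_pos _).le, zero_le_one]
  have hh0 : ∀ e, 0 ≤ h e := fun e => by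
    simp only [hh]; split_ifs; exacts [le_rfl, zero_le_one]
  calc _ ≤ ∑ F ∈ U.powerset, bernWeight p U F * (Real.exp (B.card * p / 4) *
        ((∏ e ∈ F, g e) * ∏ e ∈ U \ F, h e)) := by
        refine bernProb_le_sum h0 h1 U _ (fun F _ => mul_nonneg (Real.exp_pos _).le
          (mul_nonneg (prod_nonneg fun e _ => hg0 e) (prod_nonneg fun e _ => hh0 e))) ?_
        rintro F _ ⟨hHF, hcard⟩
        have e1 : ∏ e ∈ U \ F, h e = 1 := prod_eq_one fun e he => by
          simp only [hh]
          rw [if_neg fun heH => (mem_sdiff.1 he).2 (hHF heH)]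
        have e2 : ∏ e ∈ F, g e = Real.exp (-((B ∩ F).card : ℝ)) := by
          simp only [hg]
          rw [prod_ite, prod_const, prod_const_one, mul_one, filter_mem_eq_inter, inter_comm,
            ← Real.exp_nat_mul]
          congr 1; ring
        rw [e1, e2, mul_one, ← Real.exp_add, Real.one_le_exp_iff]
        linarith
    _ = Real.exp (B.card * p / 4) * ∏ e ∈ U, (p * g e + (1 - p) * h e) := by
        rw [← sum_bernWeight_mul, mul_sum]
        exact sum_congr rfl fun F _ => by ring
    _ ≤ Real.exp (B.card * p / 4) * ∏ e ∈ U, ((if e ∈ H then p else 1) *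
          (if e ∈ B then Real.exp (-(p / 2)) else 1)) := by
        refine mul_le_mul_of_nonneg_left (prod_le_prod (fun e _ => ?_) fun e _ => ?_)
          (Real.exp_pos _).le
        · exact add_nonneg (mul_nonneg h0 (hg0 e)) (mul_nonneg (by linarith) (hh0 e))
        · by_cases heH : e ∈ H
          · have heB : e ∉ B := fun h => disjoint_left.1 hHB h heH
            simp [hg, hh, heH, heB]
          · by_cases heB : e ∈ B
            · simp only [hg, hh, heH, heB, if_true, if_false, one_mul, mul_one]
              have e1 : Real.exp (-1) ≤ 1 / 2 := by
                rw [Real.exp_neg, inv_le_comm₀ (Real.exp_pos 1) (by norm_num)]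
                have := Real.exp_one_gt_d9
                norm_num
                linarith
              have e2 := Real.add_one_le_exp (-(p / 2))
              nlinarith
            · simp [hg, hh, heH, heB]
    _ = _ := by
        rw [prod_mul_distrib, prod_ite, prod_ite, prod_const_one, prod_const_one, mul_one, mul_one,
          prod_const, prod_const, filter_mem_eq_inter, filter_mem_eq_inter, inter_eq_right.2 hH,
          inter_eq_right.2 hB, mul_left_comm, ← Real.exp_nat_mul, ← Real.exp_add]
        congr 2; ring

/-- Chernoff bound for the upper tail. -/
lemma bernProb_upper_tail {p : ℝ} (h0 : 0 ≤ p) (h1 : p ≤ 1) {U B : Finset α} (hB : B ⊆ U)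
    {l : ℝ} (hl : 0 ≤ l) (r : ℝ) :
    bernProb p U (fun F => r ≤ ((F ∩ B).card : ℝ)) ≤
      Real.exp (p * Real.exp l * B.card - l * r) := by
  set g : α → ℝ := fun e => if e ∈ B then Real.exp l else 1 with hg
  have hg0 : ∀ e, 0 ≤ g e := fun e => by
    simp only [hg]; split_ifs; exacts [(Real.exp_pos _).le, zero_le_one]
  calc _ ≤ ∑ F ∈ U.powerset, bernWeight p U F * (Real.exp (-(l * r)) *
        ((∏ e ∈ F, g e) * ∏ e ∈ U \ F, (1 : ℝ))) := by
        refine bernProb_le_sum h0 h1 U _ (fun F _ => mul_nonneg (Real.exp_pos _).le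
          (mul_nonneg (prod_nonneg fun e _ => hg0 e) (prod_nonneg fun e _ => zero_le_one))) ?_
        intro F _ hcard
        have e2 : ∏ e ∈ F, g e = Real.exp ((F ∩ B).card * l) := by
          simp only [hg]
          rw [prod_ite, prod_const, prod_const_one, mul_one, filter_mem_eq_inter,
            ← Real.exp_nat_mul]
        rw [prod_const_one, e2, mul_one, ← Real.exp_add, Real.one_le_exp_iff]
        nlinarith
    _ = Real.exp (-(l * r)) * ∏ e ∈ U, (p * g e + (1 - p) * 1) := by
        rw [← sum_bernWeight_mul, mul_sum]
        exact sum_congr rfl fun F _ => by ring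
    _ ≤ Real.exp (-(l * r)) * ∏ e ∈ U, (if e ∈ B then Real.exp (p * Real.exp l) else 1) := by
        refine mul_le_mul_of_nonneg_left (prod_le_prod (fun e _ => ?_) fun e _ => ?_)
          (Real.exp_pos _).le
        · exact add_nonneg (mul_nonneg h0 (hg0 e)) (by linarith)
        · by_cases heB : e ∈ B
          · simp only [hg, heB, if_true]
            have e2 := Real.add_one_le_exp (p * Real.exp l)
            linarith
          · simp [hg, heB]
    _ = _ := by
        rw [prod_ite, prod_const_one, mul_one, prod_const, filter_mem_eq_inter,
          inter_eq_right.2 hB, ← Real.exp_nat_mul, ← Real.exp_add]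
        congr 1; ring

end BinomialWeights

/-! ### The binomial random graph as a random edge set. -/

section RandomGraph

variable {V : Type*} [Fintype V] [DecidableEq V]

variable (V) in
/-- The pairs of distinct vertices. -/
def allPairs : Finset (Sym2 V) := univ.filter fun e => ¬ e.IsDiag

lemma card_allPairs : (allPairs V).card = (Fintype.card V).choose 2 := by
  rw [allPairs, ← Fintype.card_subtype, Sym2.card_subtype_not_diag]

lemma card_allPairs_inter_sym2_le (Z : Finset V) :
    ((allPairs V) ∩ Z.sym2).card ≤ Z.card ^ 2 := by
  refine (card_le_card inter_subset_right).trans ?_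
  rw [card_sym2, Nat.choose_two_right, Nat.add_sub_cancel]
  refine Nat.div_le_of_le_mul ?_
  nlinarith [Nat.le_self_pow two_ne_zero Z.card]

lemma card_filter_mem_allPairs (v : V) :
    Fintype.card V - 1 ≤ ((allPairs V).filter fun e => v ∈ e).card := by
  rw [← card_univ, ← card_erase_of_mem (mem_univ v)]
  refine card_le_card_of_injOn (fun u => s(v, u)) (fun u hu => ?_) ?_
  · simp only [coe_erase, coe_univ, Set.mem_sdiff, Set.mem_univ, Set.mem_singleton_iff,
      true_and] at hu
    simp [allPairs, Ne.symm hu]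
  · intro a _ b _ hab
    rcases Sym2.eq_iff.1 hab with h | h
    · exact h.2
    · exact h.2.trans h.1

/-- The binomial random graph has a random set of edges. -/
theorem binomialRandom_real_eq_bernProb (p : unitInterval) (S : Set (SimpleGraph V)) :
    (SimpleGraph.binomialRandom V p).real S =
      bernProb (p : ℝ) (allPairs V) (fun F => graphOf F ∈ S) := by
  classical
  have : MeasurableSingletonClass (SimpleGraph V) := ⟨fun G => by
    have h := SimpleGraph.measurableEmbedding_edgeSet.measurable
      (measurableSet_singleton G.edgeSet)
    rwa [show SimpleGraph.edgeSet ⁻¹' {G.edgeSet} = {G} by ext H; simp] at h⟩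
  have hS : (S.toFinite.toFinset : Set (SimpleGraph V)) = S := by simp
  conv_lhs => rw [← hS]
  rw [← MeasureTheory.sum_measureReal_singleton, bernProb]
  symm
  have hedge : ∀ F ⊆ allPairs V, (graphOf F).edgeSet = F := by
    intro F hF
    rw [SimpleGraph.edgeSet_fromEdgeSet, sdiff_eq_left, Set.disjoint_left]
    intro e he hd
    exact (mem_filter.1 (hF he)).2 (by simpa using hd)
  have hgraph : ∀ G : SimpleGraph V, graphOf (univ.filter fun e => e ∈ G.edgeSet) = G := by
    intro G; ext a b; simpa using fun h : G.Adj a b => h.ne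
  refine sum_bij' (fun F _ => graphOf F) (fun G _ => univ.filter fun e => e ∈ G.edgeSet)
    ?_ ?_ ?_ ?_ ?_
  · intro F hF
    simpa using (mem_filter.1 hF).2
  · intro G hG
    rw [mem_filter, mem_powerset, hgraph]
    refine ⟨fun e he => ?_, by simpa using hG⟩
    simp only [allPairs, mem_filter, mem_univ, true_and] at he ⊢
    exact G.not_isDiag_of_mem_edgeSet he
  · intro F hF
    rw [mem_filter, mem_powerset] at hF
    ext e
    simp only [mem_filter, mem_univ, true_and, hedge F hF.1, mem_coe]
  · intro G _
    exact hgraph G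
  · intro F hF
    rw [mem_filter, mem_powerset] at hF
    rw [MeasureTheory.measureReal_def, SimpleGraph.binomialRandom_singleton, hedge F hF.1,
      Set.ncard_coe_finset, bernWeight, card_sdiff_of_subset hF.1, card_allPairs,
      Nat.card_eq_fintype_card]
    simp [ENNReal.toReal_mul, ENNReal.toReal_pow]

end RandomGraph

end RainbowHamilton

namespace RainbowHamilton

open Finset

/-! ### Pseudorandom properties of the binomial random graph. -/

section Tails

variable {V : Type*} [Fintype V] [DecidableEq V] {p w : ℝ}

open Classical in
lemma bernProb_exists_degree_le (h0 : 0 ≤ p) (h1 : p ≤ 1) (hn : 2 ≤ Fintype.card V) :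
    bernProb p (allPairs V) (fun E => ∃ v ∈ (univ : Finset V),
      ((E.filter fun e => v ∈ e).card : ℝ) ≤ Fintype.card V * p / 8 ∧ E ⊆ allPairs V) ≤
      Fintype.card V * Real.exp (-(Fintype.card V * p / 8)) := by
  refine (bernProb_exists_le h0 h1 _ univ _).trans (le_of_le_of_eq
    (b := ∑ _v ∈ (univ : Finset V), Real.exp (-(Fintype.card V * p / 8)))
    (sum_le_sum fun v _ => ?_) (by rw [sum_const, card_univ, nsmul_eq_mul]))
  -- The mean degree is at least `(n-1)p ≥ np/2`, so `np/8` is at most a quarter of it.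
  have hB : (Fintype.card V : ℝ) * p / 8 ≤
      (((allPairs V).filter fun e => v ∈ e).card : ℝ) * p / 4 := by
    have h2 : (Fintype.card V : ℝ) ≤ 2 * (((allPairs V).filter fun e => v ∈ e).card : ℝ) := by
      have := card_filter_mem_allPairs v
      exact_mod_cast (show Fintype.card V ≤ 2 * ((allPairs V).filter fun e => v ∈ e).card by omega)
    nlinarith
  have h := bernProb_lower_tail h0 h1 (empty_subset (allPairs V))
    (filter_subset (fun e => v ∈ e) (allPairs V)) (disjoint_empty_right _)
  rw [card_empty, pow_zero, one_mul] at h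
  refine (bernProb_mono h0 h1 fun E hE hv => ⟨empty_subset _, ?_⟩).trans
    (h.trans (Real.exp_le_exp.2 (by simpa using hB)))
  refine le_trans ?_ (hv.1.trans hB)
  have : (allPairs V).filter (fun e => v ∈ e) ∩ E = E.filter fun e => v ∈ e := by
    ext e
    simp only [mem_inter, mem_filter]
    exact ⟨fun h => ⟨h.2, h.1.2⟩, fun h => ⟨⟨hE h.1, h.2⟩, h.1⟩⟩
  rw [this]

lemma bernProb_inter_sym2_ge (h0 : 0 ≤ p) (h1 : p ≤ 1) (Z : Finset V) {l : ℝ} (hl : 0 ≤ l)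
    (r : ℝ) : bernProb p (allPairs V) (fun E => r ≤ ((E ∩ Z.sym2).card : ℝ)) ≤
      Real.exp (p * Real.exp l * (Z.card : ℝ) ^ 2 - l * r) := by
  refine (bernProb_mono (Q := fun E => r ≤ ((E ∩ (allPairs V ∩ Z.sym2)).card : ℝ)) h0 h1
    fun E hE h => ?_).trans ((bernProb_upper_tail h0 h1 inter_subset_left hl r).trans ?_)
  · rwa [← inter_assoc, inter_eq_left.2 hE]
  · have : ((allPairs V ∩ Z.sym2).card : ℝ) ≤ (Z.card : ℝ) ^ 2 := by
      exact_mod_cast card_allPairs_inter_sym2_le Z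
    gcongr

open Classical in
-- With `x = |Z|/n`, the tilt `-log (p|Z|)` bounds the probability for `Z` by `(e(w²x)⁴)^|Z|`. The
-- size restriction `xw³ ≤ 1` gives `(w²x)⁴ ≤ x/w`, and this `x` pays for the choice of `Z`.
lemma bernProb_exists_small_dense [Nonempty V] (h0 : 0 < p) (h1 : p ≤ 1) (hw : 9 < w)
    (hpw : Fintype.card V * p = w ^ 2) :
    bernProb p (allPairs V) (fun E => ∃ Z ∈ univ.filter (fun Z : Finset V => Z.Nonempty),
      Z.card * w ^ 3 ≤ Fintype.card V ∧ 4 * (Z.card : ℝ) ≤ (E ∩ Z.sym2).card) ≤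
      (9 / w) / (1 - 9 / w) := by
  have hw0 : 0 < w := by linarith
  refine (bernProb_exists_le h0.le h1 _ _ _).trans (le_trans (sum_le_sum fun Z hZ => ?_)
    (sum_nonempty_pow_le (V := V) (by positivity) ((div_lt_one hw0).2 hw)))
  have hz : (0 : ℝ) < Z.card := by exact_mod_cast (mem_filter.1 hZ).2.card_pos
  have hn : (0 : ℝ) < Fintype.card V := by exact_mod_cast Fintype.card_pos
  by_cases hsm : Z.card * w ^ 3 ≤ Fintype.card V
  · have hpz : 0 < p * Z.card := by positivity
    set x : ℝ := Z.card / Fintype.card V with hx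
    have hpx : p * Z.card = w ^ 2 * x := by rw [hx, ← hpw]; field_simp
    have hx0 : 0 < x := by positivity
    have hxw : x * w ^ 3 ≤ 1 := by
      rw [hx, div_mul_eq_mul_div, div_le_one hn]; exact hsm
    have hpz1 : p * Z.card ≤ 1 := by
      rw [hpx]
      have h2 : w ^ 2 ≤ w ^ 3 := pow_le_pow_right₀ (by linarith) (by norm_num)
      nlinarith
    have hl : 0 ≤ -Real.log (p * Z.card) := by
      have := Real.log_nonpos hpz.le hpz1; linarith
    refine (bernProb_mono (Q := fun E => 4 * (Z.card : ℝ) ≤ (E ∩ Z.sym2).card) h0.le h1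
      fun E _ h => h.2).trans ((bernProb_inter_sym2_ge h0.le h1 Z hl _).trans ?_)
    have e1 : p * Real.exp (-Real.log (p * Z.card)) * (Z.card : ℝ) ^ 2 = Z.card := by
      rw [Real.exp_neg, Real.exp_log hpz]; field_simp
    rw [e1, show (Z.card : ℝ) - -Real.log (p * Z.card) * (4 * Z.card) =
      Z.card * (1 + 4 * Real.log (p * Z.card)) by ring, Real.exp_nat_mul]
    refine pow_le_pow_left₀ (Real.exp_pos _).le ?_ _
    rw [Real.exp_add, show (4 : ℝ) * Real.log (p * Z.card) = (4 : ℕ) * Real.log (p * Z.card) by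
      norm_num, Real.exp_nat_mul, Real.exp_log hpz, hpx]
    have e2 : Real.exp 1 ≤ 3 := Real.exp_one_lt_d9.le.trans (by norm_num)
    have e3 : (Z.card : ℝ) / (3 * Fintype.card V) = x / 3 := by rw [hx]; field_simp
    rw [e3]
    have e4 : (w ^ 2 * x) ^ 4 * w ≤ x := by
      have : (x * w ^ 3) ^ 3 ≤ 1 := pow_le_one₀ (by positivity) hxw
      calc (w ^ 2 * x) ^ 4 * w = x * (x * w ^ 3) ^ 3 := by ring
        _ ≤ x * 1 := by gcongr
        _ = x := mul_one x
    rw [div_mul_eq_mul_div, le_div_iff₀ hw0]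
    calc Real.exp 1 * (w ^ 2 * x) ^ 4 * w = Real.exp 1 * ((w ^ 2 * x) ^ 4 * w) := by ring
      _ ≤ 3 * x := by gcongr
      _ = 9 * (x / 3) := by ring
  · refine le_trans (le_of_eq ?_) (show (0 : ℝ) ≤ _ by positivity)
    simp [bernProb, hsm]

open Classical in
-- With `x = |Z|/n ≤ 1/1536²`, tilt 1 makes the mean term at most half of the threshold term,
-- leaving `exp (-|Z| w²√x/512)`. Since `x > w⁻³`, one has `w²√x ≥ √w` and `1 ≤ xw³`, which supplies
-- the factor needed for the choice of `Z`.
lemma bernProb_exists_medium_dense [Nonempty V] (h0 : 0 < p) (h1 : p ≤ 1) (hw : 0 < w)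
    (hpw : Fintype.card V * p = w ^ 2) (hq : 3 * w ^ 3 * Real.exp (-(√w / 512)) < 1) :
    bernProb p (allPairs V) (fun E => ∃ Z ∈ univ.filter (fun Z : Finset V => Z.Nonempty),
      (Fintype.card V < Z.card * w ^ 3 ∧ (Z.card : ℝ) * 1536 ^ 2 ≤ Fintype.card V) ∧
        Fintype.card V * p * Z.card * √((Z.card : ℝ) / Fintype.card V) / 256 ≤
          (E ∩ Z.sym2).card) ≤
      (3 * w ^ 3 * Real.exp (-(√w / 512))) / (1 - 3 * w ^ 3 * Real.exp (-(√w / 512))) := by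
  refine (bernProb_exists_le h0.le h1 _ _ _).trans (le_trans (sum_le_sum fun Z hZ => ?_)
    (sum_nonempty_pow_le (V := V) (by positivity) hq))
  have hz : (0 : ℝ) < Z.card := by exact_mod_cast (mem_filter.1 hZ).2.card_pos
  have hn : (0 : ℝ) < Fintype.card V := by exact_mod_cast Fintype.card_pos
  by_cases hmed : Fintype.card V < Z.card * w ^ 3 ∧ (Z.card : ℝ) * 1536 ^ 2 ≤ Fintype.card V
  · set x : ℝ := Z.card / Fintype.card V with hx
    have hx0 : 0 < x := by positivity
    have hxw : 1 < x * w ^ 3 := by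
      rw [hx, div_mul_eq_mul_div, one_lt_div hn]; exact hmed.1
    have hx1 : x * 1536 ^ 2 ≤ 1 := by
      rw [hx, div_mul_eq_mul_div, div_le_one hn]; exact hmed.2
    have hsx : √x ≤ 1 / 1536 := by
      rw [Real.sqrt_le_left (by norm_num)]
      norm_num
      linarith
    have hsq : √x * √x = x := Real.mul_self_sqrt hx0.le
    have hsx0 : 0 < √x := Real.sqrt_pos.2 hx0
    have hpz : p * Z.card = w ^ 2 * x := by rw [hx, ← hpw]; field_simp
    refine (bernProb_mono (Q := fun E => Fintype.card V * p * Z.card * √x / 256 ≤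
      (E ∩ Z.sym2).card) h0.le h1 fun E _ h => h.2).trans
      ((bernProb_inter_sym2_ge h0.le h1 Z zero_le_one _).trans ?_)
    have e2 : Real.exp 1 ≤ 3 := Real.exp_one_lt_d9.le.trans (by norm_num)
    have hws : √w ≤ w ^ 2 * √x := by
      refine Real.sqrt_le_iff.2 ⟨by positivity, ?_⟩
      rw [mul_pow, Real.sq_sqrt hx0.le]
      nlinarith
    have e1 : p * Real.exp 1 * (Z.card : ℝ) ^ 2 -
        1 * (Fintype.card V * p * Z.card * √x / 256) ≤ Z.card * (-(√w / 512)) := by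
      have h3 : p * Real.exp 1 * (Z.card : ℝ) ^ 2 ≤ Z.card * (w ^ 2 * √x * (1 / 512)) := by
        calc p * Real.exp 1 * (Z.card : ℝ) ^ 2 = Z.card * ((p * Z.card) * Real.exp 1) := by ring
          _ = Z.card * (w ^ 2 * √x * (√x * Real.exp 1)) := by
            rw [hpz]
            nth_rewrite 1 [← hsq]
            ring
          _ ≤ Z.card * (w ^ 2 * √x * ((1 / 1536) * 3)) := by gcongr
          _ = _ := by ring
      have h4 : (Z.card : ℝ) * √w ≤ Z.card * (w ^ 2 * √x) := by gcongr
      rw [hpw]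
      nlinarith
    refine (Real.exp_le_exp.2 e1).trans ?_
    rw [Real.exp_nat_mul]
    refine pow_le_pow_left₀ (Real.exp_pos _).le ?_ _
    have e3 : (Z.card : ℝ) / (3 * Fintype.card V) = x / 3 := by rw [hx]; field_simp
    rw [e3, show 3 * w ^ 3 * Real.exp (-(√w / 512)) * (x / 3) =
      (x * w ^ 3) * Real.exp (-(√w / 512)) by ring]
    exact le_mul_of_one_le_left (Real.exp_pos _).le hxw.le
  · refine le_trans (le_of_eq ?_) (show (0 : ℝ) ≤ _ by positivity)
    rw [bernProb]
    simp only [hmed, false_and]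
    simp

open Classical in
-- As `B F` is disjoint from `F`, the events `F ⊆ E` and "few elements of `B F` in `E`" are
-- independent, giving `p ^ F.card` times a Chernoff factor. The sum over `F` is `sum_pow_card_le`
-- with `y = 1/w`.
lemma bernProb_exists_few_boosters (h0 : 0 ≤ p) (h1 : p ≤ 1) (hw : 1 ≤ w)
    (hpw : Fintype.card V * p = w ^ 2) (B : Finset (Sym2 V) → Finset (Sym2 V))
    (hB : ∀ F, B F ⊆ allPairs V) (hBF : ∀ F, Disjoint (B F) F) (M : ℕ) (b : ℝ) :
    bernProb p (allPairs V) (fun E => ∃ F ∈ (allPairs V).powerset.filter (fun F => F.card ≤ M),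
      b ≤ (B F).card ∧ F ⊆ E ∧ ((B F ∩ E).card : ℝ) ≤ b * p / 4) ≤
      w ^ M * Real.exp (Fintype.card V * w) * Real.exp (-(b * p / 4)) := by
  have hw0 : 0 < w := by linarith
  have hU : ((allPairs V).card : ℝ) ≤ (Fintype.card V : ℝ) ^ 2 := by
    rw [card_allPairs]; exact_mod_cast Nat.choose_le_pow _ _
  have hsum := sum_pow_card_le h0 (inv_pos.2 hw0) (inv_le_one_of_one_le₀ hw) (allPairs V) M
  rw [inv_inv] at hsum
  refine (bernProb_exists_le h0 h1 _ _ _).trans ?_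
  calc _ ≤ ∑ F ∈ (allPairs V).powerset.filter (fun F => F.card ≤ M),
        p ^ F.card * Real.exp (-(b * p / 4)) := by
        refine sum_le_sum fun F hF => ?_
        have hFU := mem_powerset.1 (mem_filter.1 hF).1
        by_cases hb : b ≤ (B F).card
        · have hbp : b * p / 4 ≤ (B F).card * p / 4 := by gcongr
          refine (bernProb_mono h0 h1 fun E _ h => ⟨h.2.1, h.2.2.trans hbp⟩).trans
            ((bernProb_lower_tail h0 h1 hFU (hB F) (hBF F)).trans ?_)
          gcongr
        · refine le_trans (le_of_eq ?_) (show (0 : ℝ) ≤ _ by positivity)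
          simp [bernProb, hb]
    _ ≤ _ := by
        rw [← sum_mul]
        refine mul_le_mul_of_nonneg_right (hsum.trans ?_) (Real.exp_pos _).le
        refine mul_le_mul_of_nonneg_left (Real.exp_le_exp.2 ?_) (pow_nonneg hw0.le _)
        calc p * w⁻¹ * (allPairs V).card ≤ p * w⁻¹ * (Fintype.card V : ℝ) ^ 2 := by gcongr
          _ = Fintype.card V * (Fintype.card V * p) * w⁻¹ := by ring
          _ = Fintype.card V * w := by rw [hpw]; field_simp

end Tails

end RainbowHamilton

namespace RainbowHamilton

open Finset

/-! ### From pseudorandomness to rainbow Hamilton cycles, and the failure probability. -/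

section Deterministic

variable {V : Type*} [Fintype V] [DecidableEq V]

open Classical in
/-- Rainbow Hamiltonicity of globally bounded colourings from pseudorandomness of the edge set. -/
theorem hasRainbowHamiltonCycle_of_pseudorandom {E : Finset (Sym2 V)} (hE : E ⊆ allPairs V)
    {p w : ℝ} (hp : 0 < p) (hn : 10 ^ 8 ≤ Fintype.card V) {s : ℕ}
    (hs1 : (Fintype.card V : ℝ) / (2 * 10 ^ 8) ≤ s) (hs2 : (s : ℝ) ≤ Fintype.card V / 10 ^ 8)
    (hdeg : ∀ v, Fintype.card V * p / 8 < ((E.filter fun e => v ∈ e).card : ℝ))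
    (hsmall : ∀ Z : Finset V, Z.Nonempty → Z.card * w ^ 3 ≤ Fintype.card V →
      ((E ∩ Z.sym2).card : ℝ) < 4 * Z.card)
    (hmed : ∀ Z : Finset V, Z.Nonempty → Fintype.card V < Z.card * w ^ 3 →
      (Z.card : ℝ) * 1536 ^ 2 ≤ Fintype.card V → ((E ∩ Z.sym2).card : ℝ) <
        Fintype.card V * p * Z.card * √((Z.card : ℝ) / Fintype.card V) / 256)
    (hB : ∀ F ⊆ E, F.card ≤ 18 * Fintype.card V →
      (s : ℝ) ^ 2 / 2 ≤ (boosters (graphOf F) \ F).card →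
      (s : ℝ) ^ 2 / 2 * p / 4 < (((boosters (graphOf F) \ F) ∩ E).card : ℝ))
    {K : Type*} (c : (graphOf E).EdgeLabeling K)
    (hc : IsGloballyBounded c (1 / 10 ^ 19 * Fintype.card V * p)) :
    HasRainbowHamiltonCycle c := by
  have hn0 : 0 < Fintype.card V := lt_of_lt_of_le (by norm_num) hn
  have hnR : (10 ^ 8 : ℝ) ≤ Fintype.card V := by exact_mod_cast hn
  have hnR0 : (0 : ℝ) < Fintype.card V := by exact_mod_cast hn0
  have : Nonempty V := Fintype.card_pos_iff.1 hn0
  have hd : 0 < (Fintype.card V : ℝ) * p := by positivity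
  have hdiag : ∀ e ∈ E, ¬ e.IsDiag := fun e he => (mem_filter.1 (hE he)).2
  have hmem : ∀ e, e ∈ (graphOf E).edgeSet ↔ e ∈ E := by
    intro e
    rw [SimpleGraph.edgeSet_fromEdgeSet]
    simp only [Set.mem_sdiff, mem_coe]
    exact ⟨fun h => h.1, fun h => ⟨h, fun hd => hdiag e h (by simpa using hd)⟩⟩
  -- The colouring is extended to all pairs; the extra colour `none` does not occur on `E`.
  set c' : Sym2 V → Option K := fun e =>
    if h : e ∈ (graphOf E).edgeSet then some (c ⟨e, h⟩) else none with hc'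
  set M : ℕ := ⌊1 / 10 ^ 19 * Fintype.card V * p⌋₊ with hM
  set D : ℕ := ⌈(Fintype.card V : ℝ) * p / 8⌉₊ with hD
  have hMle : (M : ℝ) ≤ 1 / 10 ^ 19 * Fintype.card V * p := Nat.floor_le (by positivity)
  have hDle : (Fintype.card V : ℝ) * p / 8 ≤ D := Nat.le_ceil _
  have hcM : ∀ k, (@Finset.filter _ (fun e => c' e = k)
      (fun _ => Classical.propDecidable _) E).card ≤ M := by
    rintro (_ | k)
    · refine (card_eq_zero.2 (eq_empty_of_forall_notMem fun e he => ?_)).le.trans (Nat.zero_le _)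
      simp only [mem_filter] at he
      simp [hc', he.1, hdiag e he.1] at he
    · refine Nat.le_floor ((Nat.cast_le.2 ?_).trans (hc k).2)
      rw [← Set.ncard_coe_finset, ← Set.ncard_image_of_injective _ Subtype.val_injective]
      refine Set.ncard_le_ncard (fun e he => ?_) ((hc k).1.image _)
      simp only [coe_filter, Set.mem_ofPred_eq] at he
      have heE := (hmem e).2 he.1
      simp only [hc', heE, dite_true, Option.some.injEq] at he
      exact ⟨⟨e, heE⟩, he.2, rfl⟩
  obtain ⟨F₀, hF₀E, hF₀c, hF₀card, hF₀s⟩ := exists_rainbow_expander (s := s) hdiag (c := c')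
    (D := D) (M := M) (Nat.ceil_pos.2 (by positivity))
    (fun v => Nat.ceil_le.2 (hdeg v).le)
    (by
      have : (128 * M : ℝ) ≤ D := by nlinarith
      exact_mod_cast this)
    hcM (fun z => (z : ℝ) * w ^ 3 ≤ Fintype.card V)
    (fun Z hZ hsm => by exact_mod_cast hsmall Z hZ hsm)
    -- Here `|Z| < 4s ≤ 4n/10⁸`, which is below `n/1536²`, and `np/256 ≤ D/32`.
    (fun Z hZ hsm hZs => by
      have hZs' : (Z.card : ℝ) ≤ 4 * s := by exact_mod_cast hZs.le
      refine (hmed Z hZ (not_le.1 hsm) (by linarith)).le.trans ?_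
      have h1 : 0 ≤ (Z.card : ℝ) * √((Z.card : ℝ) / Fintype.card V) := by positivity
      nlinarith)
  have hs0 : 1 ≤ s := by
    have : (0 : ℝ) < s := lt_of_lt_of_le (by positivity) hs1
    exact_mod_cast this
  obtain ⟨F, hFE, hFc, hF⟩ := exists_rainbow_isHamiltonian hs0
    (le_trans (by norm_num) hn) hcM hF₀E hF₀c hF₀card hF₀s (fun F hFE hFcard hFs => by
      have h1 := hB F hFE hFcard (by
        have : (s : ℝ) ^ 2 ≤ 2 * (boosters (graphOf F) \ F).card := by exact_mod_cast hFs
        linarith)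
      -- This fixes the constant: `18/10¹⁹` must not exceed `1/(8 · (2 · 10⁸)²)`.
      have h2 : ((18 * Fintype.card V * M : ℕ) : ℝ) ≤ (s : ℝ) ^ 2 / 2 * p / 4 := by
        push_cast
        have h3 : ((Fintype.card V : ℝ) / (2 * 10 ^ 8)) ^ 2 ≤ (s : ℝ) ^ 2 := by gcongr
        calc (18 * Fintype.card V * M : ℝ)
            ≤ 18 * Fintype.card V * (1 / 10 ^ 19 * Fintype.card V * p) := by gcongr
          _ = (18 / 10 ^ 19 * (Fintype.card V : ℝ) ^ 2) * p := by ring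
          _ ≤ (((Fintype.card V : ℝ) / (2 * 10 ^ 8)) ^ 2 / 2 / 4) * p := by
              gcongr
              rw [div_pow]
              norm_num
              nlinarith [sq_nonneg (Fintype.card V : ℝ)]
          _ ≤ ((s : ℝ) ^ 2 / 2 / 4) * p := by gcongr
          _ = _ := by ring
      exact_mod_cast h2.trans_lt h1)
  obtain ⟨v, q, hq⟩ := hF (by omega)
  have hle : graphOf F ≤ graphOf E := SimpleGraph.fromEdgeSet_mono (coe_subset.2 hFE)
  refine ⟨v, q.map (.ofLE hle), hq.map Function.bijective_id, ?_⟩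
  have hqF : ∀ e ∈ (q.map (SimpleGraph.Hom.ofLE hle)).toSubgraph.edgeSet, e ∈ F := by
    intro e he
    rw [SimpleGraph.Walk.mem_edges_toSubgraph, SimpleGraph.Walk.edges_map] at he
    obtain ⟨e', he', rfl⟩ := List.mem_map.1 he
    have := q.edges_subset_edgeSet he'
    rw [SimpleGraph.edgeSet_fromEdgeSet] at this
    have h2 : Sym2.map (SimpleGraph.Hom.ofLE hle) e' = e' := congrFun Sym2.map_id' e'
    rw [h2]
    exact mem_coe.1 this.1
  intro e f he hf hef hcef
  refine hef (Subtype.ext (hFc (mem_coe.2 (hqF _ he)) (mem_coe.2 (hqF _ hf)) ?_))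
  simp only [hc', e.2, f.2, dite_true, Option.some.injEq]
  exact hcef

open Classical in
/-- The probability that some globally bounded colouring has no rainbow Hamilton cycle. -/
theorem binomialRandom_real_compl_le (p : unitInterval) {w : ℝ} (hp : 0 < (p : ℝ))
    (hn : 10 ^ 8 ≤ Fintype.card V) (hw : 10 ^ 20 ≤ w)
    (hpw : Fintype.card V * (p : ℝ) = w ^ 2) (hq : 3 * w ^ 3 * Real.exp (-(√w / 512)) < 1)
    (hlog : 16 * Real.log (Fintype.card V) ≤ w ^ 2) :
    (SimpleGraph.binomialRandom V p).real {G : SimpleGraph V | ∀ (K : Type*)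
      (c : G.EdgeLabeling K), IsGloballyBounded c (1 / 10 ^ 19 * (Fintype.card V : ℝ) * (p : ℝ)) →
      HasRainbowHamiltonCycle c}ᶜ ≤
      1 / (Fintype.card V : ℝ) + (9 / w) / (1 - 9 / w) +
      (3 * w ^ 3 * Real.exp (-(√w / 512))) / (1 - 3 * w ^ 3 * Real.exp (-(√w / 512))) +
      Real.exp (-(Fintype.card V : ℝ)) := by
  have hn0 : 0 < Fintype.card V := lt_of_lt_of_le (by norm_num) hn
  have hnR : (10 ^ 8 : ℝ) ≤ Fintype.card V := by exact_mod_cast hn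
  have hnR0 : (0 : ℝ) < Fintype.card V := by exact_mod_cast hn0
  have hw0 : 0 < w := lt_of_lt_of_le (by positivity) hw
  have : Nonempty V := Fintype.card_pos_iff.1 hn0
  have h1 : (p : ℝ) ≤ 1 := p.2.2
  set s : ℕ := ⌊(Fintype.card V : ℝ) / 10 ^ 8⌋₊ with hs
  have hs2 : (s : ℝ) ≤ Fintype.card V / 10 ^ 8 := Nat.floor_le (by positivity)
  have hs1 : (Fintype.card V : ℝ) / (2 * 10 ^ 8) ≤ s := by
    have h1s : 1 ≤ s := (Nat.one_le_floor_iff _).2 ((one_le_div (by positivity)).2 hnR)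
    have h2 : (1 : ℝ) ≤ s := by exact_mod_cast h1s
    have h3 := Nat.lt_floor_add_one ((Fintype.card V : ℝ) / 10 ^ 8)
    rw [← hs] at h3
    have h4 : (Fintype.card V : ℝ) / (2 * 10 ^ 8) = Fintype.card V / 10 ^ 8 / 2 := by ring
    rw [h4]
    linarith
  rw [binomialRandom_real_eq_bernProb]
  set B : Finset (Sym2 V) → Finset (Sym2 V) := fun F => boosters (graphOf F) \ F with hB
  have hBU : ∀ F, B F ⊆ allPairs V := fun F e he =>
    mem_filter.2 ⟨mem_univ _, (mem_boosters.1 (mem_sdiff.1 he).1).1⟩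
  have hBF : ∀ F, Disjoint (B F) F := fun F => sdiff_disjoint
  have t1 := bernProb_exists_degree_le (V := V) hp.le h1 (le_trans (by norm_num) hn)
  have t2 := bernProb_exists_small_dense (V := V) hp h1 (lt_of_lt_of_le (by norm_num) hw) hpw
  have t3 := bernProb_exists_medium_dense (V := V) hp h1 hw0 hpw hq
  have t4 := bernProb_exists_few_boosters hp.le h1 (le_trans (by norm_num) hw) hpw B hBU hBF
    (18 * Fintype.card V) ((s : ℝ) ^ 2 / 2)
  have u1 : Fintype.card V * Real.exp (-(Fintype.card V * (p : ℝ) / 8)) ≤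
      1 / (Fintype.card V : ℝ) := by
    have e1 : Real.exp (-(Fintype.card V * (p : ℝ) / 8)) ≤
        Real.exp (-(Real.log (Fintype.card V) + Real.log (Fintype.card V))) := by
      rw [hpw]; exact Real.exp_le_exp.2 (by linarith)
    rw [Real.exp_neg (Real.log (Fintype.card V : ℝ) + _), Real.exp_add,
      Real.exp_log hnR0] at e1
    calc _ ≤ (Fintype.card V : ℝ) * ((Fintype.card V : ℝ) * Fintype.card V)⁻¹ := by gcongr
      _ = _ := by field_simp
  -- The union bound costs at most `exp (19nw)`, while the Chernoff exponent is at least `nw²/(32 ·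
  -- 10¹⁶) ≥ 20nw` because `w ≥ 10²⁰`.
  have u4 : w ^ (18 * Fintype.card V) * Real.exp (Fintype.card V * w) *
      Real.exp (-((s : ℝ) ^ 2 / 2 * p / 4)) ≤ Real.exp (-(Fintype.card V : ℝ)) := by
    have e1 : w ≤ Real.exp w := by linarith [Real.add_one_le_exp w]
    have h3 : ((Fintype.card V : ℝ) / (2 * 10 ^ 8)) ^ 2 ≤ (s : ℝ) ^ 2 := by gcongr
    calc _ ≤ Real.exp w ^ (18 * Fintype.card V) * Real.exp (Fintype.card V * w) *
          Real.exp (-((s : ℝ) ^ 2 / 2 * p / 4)) := by gcongr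
      _ = Real.exp (Fintype.card V * (19 * w) - (s : ℝ) ^ 2 * (p / 8)) := by
          rw [← Real.exp_nat_mul, ← Real.exp_add, ← Real.exp_add]
          push_cast
          congr 1; ring
      _ ≤ _ := by
          refine Real.exp_le_exp.2 ?_
          have h5 : ((Fintype.card V : ℝ) / (2 * 10 ^ 8)) ^ 2 * (p / 8) ≤ (s : ℝ) ^ 2 * (p / 8) := by
            gcongr
          have h6 : ((Fintype.card V : ℝ) / (2 * 10 ^ 8)) ^ 2 * (p / 8) =
              Fintype.card V * (w ^ 2 / (32 * 10 ^ 16)) := by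
            rw [← hpw]; ring
          have h7 : 20 * w ≤ w ^ 2 / (32 * 10 ^ 16) := by
            rw [le_div_iff₀ (by positivity)]
            nlinarith
          have h8 : Fintype.card V * (20 * w) ≤ Fintype.card V * (w ^ 2 / (32 * 10 ^ 16)) := by
            gcongr
          have h9 : (Fintype.card V : ℝ) * 1 ≤ Fintype.card V * w := by
            gcongr; exact le_trans (by norm_num) hw
          linarith
  refine le_trans ?_ (add_le_add (add_le_add (add_le_add (t1.trans u1) t2) t3) (t4.trans u4))
  refine le_trans ?_ (add_le_add_left (add_le_add_left (bernProb_or_le hp.le h1 _ _ _) _) _)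
  refine le_trans ?_ (add_le_add_left (bernProb_or_le hp.le h1 _ _ _) _)
  refine le_trans ?_ (bernProb_or_le hp.le h1 _ _ _)
  refine bernProb_mono hp.le h1 fun E hE hbad => ?_
  by_contra hcon
  simp only [not_or, not_exists, not_and, mem_filter, mem_univ, true_and, mem_powerset,
    not_le] at hcon
  obtain ⟨⟨⟨g1, g2⟩, g3⟩, g4⟩ := hcon
  refine hbad fun K c hc => hasRainbowHamiltonCycle_of_pseudorandom hE hp hn hs1 hs2
    (fun v => ?_) g2 (fun Z hZ h2 h3 => g3 Z hZ ⟨h2, h3⟩)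
    (fun F hF hFc hFs => g4 F ⟨hF.trans hE, hFc⟩ hFs hF) c hc
  by_contra! hv
  exact g1 v hv hE

end Deterministic

end RainbowHamilton

namespace RainbowHamilton

/-! ### Asymptotics and conclusion. -/

open Filter Topology

/-- The probability of failure in `binomialRandom_real_compl_le`. -/
noncomputable def failureBound (m w : ℝ) : ℝ :=
  1 / m + (9 / w) / (1 - 9 / w) +
    (3 * w ^ 3 * Real.exp (-(√w / 512))) / (1 - 3 * w ^ 3 * Real.exp (-(√w / 512))) +
    Real.exp (-m)

lemma tendsto_pow_mul_exp_neg_sqrt :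
    Tendsto (fun w : ℝ => 3 * w ^ 3 * Real.exp (-(√w / 512))) atTop (𝓝 0) := by
  have h := ((Real.tendsto_pow_mul_exp_neg_atTop_nhds_zero 6).comp
    (Real.tendsto_sqrt_atTop.atTop_div_const (show (0 : ℝ) < 512 by norm_num))).const_mul
    (3 * 512 ^ 6)
  rw [mul_zero] at h
  refine h.congr' ?_
  filter_upwards [eventually_ge_atTop 0] with w hw
  have : √w ^ 6 = w ^ 3 := by
    rw [show (6 : ℕ) = 2 * 3 by rfl, pow_mul, Real.sq_sqrt hw]
  simp only [Function.comp_apply, div_pow, this]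
  ring

lemma tendsto_failureBound {w : ℕ → ℝ} (hw : Tendsto w atTop atTop) :
    Tendsto (fun n : ℕ => failureBound n (w n)) atTop (𝓝 0) := by
  have h1 : Tendsto (fun n : ℕ => 1 / (n : ℝ)) atTop (𝓝 0) := tendsto_one_div_atTop_nhds_zero_nat
  have h2 : Tendsto (fun n => 9 / w n) atTop (𝓝 0) := hw.const_div_atTop 9
  have h3 := tendsto_pow_mul_exp_neg_sqrt.comp hw
  have h4 : Tendsto (fun n : ℕ => Real.exp (-(n : ℝ))) atTop (𝓝 0) :=
    Real.tendsto_exp_neg_atTop_nhds_zero.comp tendsto_natCast_atTop_atTop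
  have h5 := ((h1.add (h2.div (h2.const_sub 1) (by norm_num))).add
    (h3.div (h3.const_sub 1) (by norm_num))).add h4
  simpa [failureBound] using h5

end RainbowHamilton

open Filter Topology in
theorem theorem3 :
    ∃ μ : ℝ, 0 < μ ∧
      ∀ p : ℕ → unitInterval,
        Asymptotics.IsLittleO Filter.atTop
          (fun n : ℕ => Real.log (n : ℝ) / (n : ℝ)) (fun n : ℕ => (p n : ℝ)) →
        Filter.Tendsto
          (fun n : ℕ => SimpleGraph.binomialRandom (Fin n) (p n)
            {G : SimpleGraph (Fin n) |
              ∀ (K : Type*) (c : G.EdgeLabeling K),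
                RainbowHamilton.IsGloballyBounded c (μ * (n : ℝ) * (p n : ℝ)) →
                RainbowHamilton.HasRainbowHamiltonCycle c})
          Filter.atTop (nhds 1) := by
  refine ⟨1 / 10 ^ 19, by positivity, fun p hp => ?_⟩
  -- The constant 16 makes `n · exp (-np/8) ≤ 1/n` in the minimum degree bound; the divergence of
  -- `np` follows as well.
  have hlog : ∀ᶠ n : ℕ in atTop, 16 * Real.log n ≤ n * p n := by
    filter_upwards [hp.bound (show (0 : ℝ) < 1 / 16 by norm_num), eventually_gt_atTop 0]
      with n hn hn0
    have hn0' : (0 : ℝ) < n := by exact_mod_cast hn0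
    rw [Real.norm_of_nonneg (p n).2.1] at hn
    have h1 := (Real.le_norm_self _).trans hn
    rw [div_le_iff₀ hn0'] at h1
    linarith
  have hd : Tendsto (fun n : ℕ => (n : ℝ) * p n) atTop atTop := by
    have h1 : Tendsto (fun n : ℕ => 16 * Real.log (n : ℝ)) atTop atTop :=
      (Real.tendsto_log_atTop.comp tendsto_natCast_atTop_atTop).const_mul_atTop (by norm_num)
    exact tendsto_atTop_mono' _ hlog h1
  have hw : Tendsto (fun n : ℕ => √((n : ℝ) * p n)) atTop atTop :=
    Real.tendsto_sqrt_atTop.comp hd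
  have hlim : Tendsto (fun n : ℕ =>
      1 - ENNReal.ofReal (RainbowHamilton.failureBound n √((n : ℝ) * p n))) atTop (𝓝 1) := by
    have h1 := ENNReal.tendsto_ofReal (RainbowHamilton.tendsto_failureBound hw)
    have h2 := ENNReal.Tendsto.sub (tendsto_const_nhds (x := (1 : ENNReal)) (f := atTop)) h1
      (Or.inl ENNReal.one_ne_top)
    simpa using h2
  refine tendsto_of_tendsto_of_tendsto_of_le_of_le' hlim tendsto_const_nhds ?_
    (Eventually.of_forall fun n => MeasureTheory.prob_le_one)
  filter_upwards [hlog, hd.eventually_gt_atTop 0, hw.eventually_ge_atTop (10 ^ 20),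
    (RainbowHamilton.tendsto_pow_mul_exp_neg_sqrt.comp hw).eventually_lt_const zero_lt_one,
    eventually_ge_atTop (10 ^ 8)] with n h1 h2 h3 h4 h5
  have hp0 : 0 < (p n : ℝ) := pos_of_mul_pos_right h2 (Nat.cast_nonneg n)
  have hsq : (n : ℝ) * p n = √((n : ℝ) * p n) ^ 2 := (Real.sq_sqrt h2.le).symm
  have key := RainbowHamilton.binomialRandom_real_compl_le (V := Fin n) (p n) hp0
    (by rwa [Fintype.card_fin]) h3 (by rw [Fintype.card_fin]; exact hsq) h4
    (by rw [Fintype.card_fin, ← hsq]; exact h1)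
  rw [Fintype.card_fin] at key
  rw [tsub_le_iff_right]
  -- Subadditivity `1 ≤ μ(S) + μ(Sᶜ)` is enough, so measurability of the event is not needed.
  refine (MeasureTheory.measure_univ.symm.le.trans
    (MeasureTheory.measure_univ_le_add_compl _)).trans (add_le_add le_rfl ?_)
  rw [← MeasureTheory.ofReal_measureReal]
  exact ENNReal.ofReal_le_ofReal key
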